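/- **Setting.** Indices run over $0,1,2,3$, repeated indices are summed, $\eta=\mathrm{diag}(-1,1,1,1)$. Let $\hbar,m,q$ be real with $\hbar,m\ne0$, let $A_a$ be smooth real functions on $\mathbb R^4$, $F_{ab}=A_{b,a}-A_{a,b}$ (a comma denotes partial derivatives) and $D_a=\partial_a-\imath\frac q\hbar A_a$. Fix a unital algebra $\mathcal F$ of smooth complex functions on $\mathbb R^4$ that contains the coordinates $x^a$ and the $F_{ab}$ and is closed under partial derivatives (for instance $C^\infty(\mathbb R^4)$). The electromagnetic Heisenberg algebra $A$ is the complex algebra generated by $\mathcal F$ and $p_0,\dots,p_3$ with $[f,p_a]=\imath\hbar f_{,a}$ for $f\in\mathcal F$ (so $[x^a,p_b]=\imath\hbar\delta^a{}_b$) and $[p_a,p_b]=\imath\hbar qF_{ab}$. Its calculus $(\Omega^1_A,\mathrm d)$ is the universal first order differential calculus with an additional central 1-form $\theta'$ subject to, for $f\in\mathcal F$, $$\mathrm df=f_{,a}\mathrm dx^a-\tfrac{\imath\hbar}{2m}\eta^{ab}f_{,ab}\theta',\qquad [\mathrm dx^a,f]=-\tfrac{\imath\hbar}m\eta^{ab}f_{,b}\theta',\qquad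 [\mathrm dp_c,f]=\tfrac{\imath\hbar q}m\eta^{ab}F_{bc}f_{,a}\theta',$$ $$[\mathrm dx^a,p_c]=\tfrac{\imath\hbar q}m\eta^{ab}F_{bc}\theta',\qquad [\mathrm dp_c,p_d]=-\imath\hbar qF_{ac,d}\mathrm dx^a-\tfrac{\hbar q}{2m}\eta^{ab}(\hbar F_{bc,ad}+2\imath qF_{ac}F_{bd})\theta'.$$ For algebras $A,B$ with calculi, a right $A$-$B$-bimodule connection on an $A$-$B$-bimodule $E$ is a linear map $\nabla_E:E\to E\otimes_B\Omega^1_B$ together with a bimodule map $\sigma_E:\Omega^1_A\otimes_AE\to E\otimes_B\Omega^1_B$ such that $\nabla_E(e b)=\nabla_E(e)b+e\otimes\mathrm db$ and $\nabla_E(ae)=a\nabla_E(e)+\sigma_E(\mathrm da\otimes e)$. Tensor products carry the connection $\nabla_{E\otimes F}=(\mathrm{id}\otimes\sigma_F)(\nabla_E\otimes\mathrm{id})+\mathrm{id}\otimes\nabla_F$. Given connections on $\Omega^1_A,\Omega^1_B,E$, put $\nabla\!\!\!\!\nabla(\sigma_E)=\nabla_{E\otimes_B\Omega^1_B}\sigma_E-(\sigma_E\otimes\mathrm{id})\nabla_{\Omega^1_A\otimes_AE}$.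 Let $B=C^\infty(\mathbb R)$ (complex functions of $s$) with its classical calculus $\Omega^1_B=B\,\mathrm ds$ and connection $\nabla\,\mathrm ds=0$, $\sigma=\mathrm{id}$. Let $E$ be any vector space of smooth complex functions $\phi(s,x)$ on $\mathbb R\times\mathbb R^4$ that is stable under multiplication by $\mathcal F$ and by $B$, under the $D_a$ and under $\partial_s$ (for instance an invariant domain inside $C^\infty(\mathbb R,L^2(\mathbb R^{1,3}))$). It is an $A$-$B$-bimodule, functions acting by multiplication and $p_a$ by $-\imath\hbar D_a$. Put $$\nabla_E\phi=\Big(\frac{\partial\phi}{\partial s}-\frac{\imath\hbar}{2m}\eta^{ab}D_aD_b\phi\Big)\otimes\mathrm ds.$$ **Theorem.** The 1-forms $\mathrm dx^a,\mathrm dp_c,\theta'$ are a basis of $\Omega^1_A$ as a left $A$-module. There is a right bimodule connection $\nabla:\Omega^1_A\to\Omega^1_A\otimes_A\Omega^1_A$ with $\nabla\theta'=0$ and $$\nabla(\mathrm dx^d)=-\tfrac qm\eta^{cd}F_{ac}\,\theta'\otimes\mathrm dx^a+\theta'\otimes\tfrac{\imath\hbar q}{2m^2}\eta^{ab}\eta^{cd}F_{bc,a}\theta',$$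 $$\nabla(\mathrm dp_c)=-qF_{dc,e}\,\mathrm dx^d\otimes\mathrm dx^e-\xi_c\otimes\theta'-\theta'\otimes\eta_c+N_c\,\theta'\otimes\theta',$$ where $$N_c=-\tfrac{\imath\hbar q^2}{2m^2}\eta^{nk}\eta^{ab}(2F_{an}F_{kc,b}+F_{bn,a}F_{kc})+\tfrac{\hbar^2q}{4m^2}\eta^{nk}\eta^{ab}F_{bc,ank},$$ $$\xi_c=-\tfrac{\imath\hbar q}{2m}\eta^{nk}F_{ac,nk}\mathrm dx^a,\qquad \eta_c=-\tfrac{\imath\hbar q}{2m}\eta^{nk}F_{nc,ka}\mathrm dx^a-\tfrac{q^2}m\eta^{eb}F_{ec}F_{ab}\mathrm dx^a.$$ Its braiding $\sigma$ is the flip when one factor is $\theta'$, and $$\sigma(\mathrm dx^e\otimes\mathrm dx^d)=\mathrm dx^d\otimes\mathrm dx^e+\tfrac{\imath\hbar q}{m^2}\eta^{cd}\eta^{ae}F_{ac}\,\theta'\otimes\theta',$$ $$\sigma(\mathrm dp_e\otimes\mathrm dx^d)=\mathrm dx^d\otimes\mathrm dp_e+\tfrac{\imath\hbar q}m\eta^{dc}\theta'\otimes\big(-F_{ae,c}\mathrm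 dx^a-\tfrac qm\eta^{ab}F_{ac}F_{be}\theta'+\tfrac{\imath\hbar}{2m}\eta^{ab}F_{ae,cb}\theta'\big),$$ $$\sigma(\mathrm dx^a\otimes\mathrm dp_c)=\mathrm dp_c\otimes\mathrm dx^a+\tfrac{\imath\hbar q}m\eta^{ea}F_{dc,e}\,\mathrm dx^d\otimes\theta'-\big(\tfrac{\imath\hbar q^2}{m^2}\eta^{bn}\eta^{ra}F_{nc}F_{rb}-\tfrac{\hbar^2q}{2m^2}\eta^{ar}\eta^{nb}F_{bc,nr}\big)\theta'\otimes\theta',$$ $$\begin{aligned}\sigma(\mathrm dp_e\otimes\mathrm dp_d)={}&\mathrm dp_d\otimes\mathrm dp_e+\tfrac{\imath\hbar q^2}m\eta^{rp}\big(F_{rd}F_{ae,p}\,\theta'\otimes\mathrm dx^a-F_{re}F_{ad,p}\,\mathrm dx^a\otimes\theta'\big)\\&+\tfrac{\imath\hbar q^3}{m^2}\eta^{rp}\eta^{ba}F_{pe}F_{ad}F_{rb}\,\theta'\otimes\theta'+\tfrac{\hbar^2q^2}{2m^2}\eta^{rp}\eta^{ab}\big(F_{pd}F_{be,ar}-F_{pd,ar}F_{be}\big)\theta'\otimes\theta'.\end{aligned}$$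 For every $E$ as above, $\nabla_E$ is a right $A$-$B$-bimodule connection, with $\sigma_E(\theta'\otimes\phi)=\phi\otimes\mathrm ds$, $\sigma_E(\mathrm dx^a\otimes\phi)=-\frac{\imath\hbar}m\eta^{ab}D_b\phi\otimes\mathrm ds$ and $\sigma_E(\mathrm dp_c\otimes\phi)=\frac q{2m}\eta^{ab}(2F_{ca}p_b-\imath\hbar F_{cb,a})\phi\otimes\mathrm ds$, and with respect to $\nabla$ one has $\nabla\!\!\!\!\nabla(\sigma_E)=0$. -/

import Mathlib

open scoped TensorProduct ContDiff
open MulOpposite (op)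

noncomputable section

namespace QGeo

/-! ## Bimodules over complex algebras and their tensor products -/

/-- `M` is an `A`-`B`-bimodule (over `ℂ`): commuting unital left `A`- and right `B`-actions
by `ℂ`-linear maps. -/
class Bimodule (A B : outParam Type) (M : Type) [Ring A] [Algebra ℂ A] [Ring B] [Algebra ℂ B]
    [AddCommGroup M] [Module ℂ M] where
  left : A →ₐ[ℂ] Module.End ℂ M
  right : Bᵐᵒᵖ →ₐ[ℂ] Module.End ℂ M
  left_right : ∀ a b m, left a (right b m) = right b (left a m)

section Bimodules

variable {A B C D : Type} [Ring A] [Algebra ℂ A] [Ring B] [Algebra ℂ B] [Ring C] [Algebra ℂ C]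
  [Ring D] [Algebra ℂ D]
variable {M N K : Type} [AddCommGroup M] [Module ℂ M] [AddCommGroup N] [Module ℂ N]
  [AddCommGroup K] [Module ℂ K]

/-- left action `a.m` -/
def lact [Bimodule A B M] (a : A) (m : M) : M := Bimodule.left (B := B) a m

/-- right action `m.b` -/
def ract [Bimodule A B M] (m : M) (b : B) : M := Bimodule.right (A := A) (op b) m

infixr:73 " ▷ " => lact
infixl:73 " ◁ " => ract

section basic
variable [Bimodule A B M]

theorem one_lact (m : M) : (1 : A) ▷ m = m := by simp [lact]
theorem mul_lact (a a' : A) (m : M) : (a * a') ▷ m = a ▷ a' ▷ m := by simp [lact]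
theorem add_lact (a a' : A) (m : M) : (a + a') ▷ m = a ▷ m + a' ▷ m := by simp [lact]
theorem smul_lact (c : ℂ) (a : A) (m : M) : (c • a) ▷ m = c • (a ▷ m) := by simp [lact]
theorem lact_add (a : A) (m m' : M) : a ▷ (m + m') = a ▷ m + a ▷ m' := by simp [lact]
theorem lact_smul (c : ℂ) (a : A) (m : M) : a ▷ (c • m) = c • (a ▷ m) := by simp [lact]
theorem ract_one (m : M) : m ◁ (1 : B) = m := by simp [ract]
theorem ract_mul (m : M) (b b' : B) : m ◁ (b * b') = m ◁ b ◁ b' := by simp [ract]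
theorem ract_add (m : M) (b b' : B) : m ◁ (b + b') = m ◁ b + m ◁ b' := by simp [ract]
theorem ract_smul (c : ℂ) (m : M) (b : B) : m ◁ (c • b) = c • (m ◁ b) := by simp [ract]
theorem add_ract (m m' : M) (b : B) : (m + m') ◁ b = m ◁ b + m' ◁ b := by simp [ract]
theorem smul_ract (c : ℂ) (m : M) (b : B) : (c • m) ◁ b = c • (m ◁ b) := by simp [ract]
theorem lact_ract (a : A) (m : M) (b : B) : a ▷ (m ◁ b) = (a ▷ m) ◁ b :=
  Bimodule.left_right a (op b) m

end basic

/-- The relations `(m.b) ⊗ n = m ⊗ (b.n)`. -/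
def balanced (M N : Type) [AddCommGroup M] [Module ℂ M] [AddCommGroup N] [Module ℂ N]
    [Bimodule A B M] [Bimodule B C N] : Submodule ℂ (M ⊗[ℂ] N) :=
  Submodule.span ℂ {z | ∃ (m : M) (b : B) (n : N), z = (m ◁ b) ⊗ₜ[ℂ] n - m ⊗ₜ[ℂ] (b ▷ n)}

/-- The tensor product `M ⊗_B N` of an `A`-`B`-bimodule and a `B`-`C`-bimodule. -/
def BTensor (M N : Type) [AddCommGroup M] [Module ℂ M] [AddCommGroup N] [Module ℂ N]
    [Bimodule A B M] [Bimodule B C N] : Type :=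
  (M ⊗[ℂ] N) ⧸ balanced M N

section tensor

variable [Bimodule A B M] [Bimodule B C N]

instance : AddCommGroup (BTensor M N) := inferInstanceAs (AddCommGroup ((M ⊗[ℂ] N) ⧸ balanced M N))
instance : Module ℂ (BTensor M N) := inferInstanceAs (Module ℂ ((M ⊗[ℂ] N) ⧸ balanced M N))

/-- the universal balanced bilinear map -/
def tmulₗ (M N : Type) [AddCommGroup M] [Module ℂ M] [AddCommGroup N] [Module ℂ N]
    [Bimodule A B M] [Bimodule B C N] : M →ₗ[ℂ] N →ₗ[ℂ] BTensor M N :=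
  (TensorProduct.mk ℂ M N).compr₂ (balanced M N).mkQ

/-- `m ⊗ n` in `M ⊗_B N` -/
def tmul (m : M) (n : N) : BTensor M N := tmulₗ M N m n

infixl:70 " ⊠ " => tmul

theorem tmul_balanced (m : M) (b : B) (n : N) : (m ◁ b) ⊠ n = m ⊠ (b ▷ n) := by
  refine (Submodule.Quotient.eq _).2 (Submodule.subset_span ⟨m, b, n, rfl⟩)

theorem tmul_add (m : M) (n n' : N) : m ⊠ (n + n') = m ⊠ n + m ⊠ n' := map_add _ _ _
theorem add_tmul (m m' : M) (n : N) : (m + m') ⊠ n = m ⊠ n + m' ⊠ n :=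
  LinearMap.map_add₂ _ _ _ _
theorem tmul_smul (c : ℂ) (m : M) (n : N) : m ⊠ (c • n) = c • (m ⊠ n) := map_smul _ _ _
theorem smul_tmul (c : ℂ) (m : M) (n : N) : (c • m) ⊠ n = c • (m ⊠ n) :=
  LinearMap.map_smul₂ _ _ _ _

/-- a balanced bilinear map factors through `M ⊗_B N` -/
def BTensor.lift (f : M →ₗ[ℂ] N →ₗ[ℂ] K)
    (hf : ∀ (m : M) (b : B) (n : N), f (m ◁ b) n = f m (b ▷ n)) : BTensor M N →ₗ[ℂ] K :=
  (balanced M N).liftQ (TensorProduct.lift f) (by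
    refine Submodule.span_le.2 ?_
    rintro _ ⟨m, b, n, rfl⟩
    simp [hf])

theorem BTensor.lift_tmul (f : M →ₗ[ℂ] N →ₗ[ℂ] K)
    (hf : ∀ (m : M) (b : B) (n : N), f (m ◁ b) n = f m (b ▷ n)) (m : M) (n : N) :
    BTensor.lift f hf (m ⊠ n) = f m n := by
  exact TensorProduct.lift.tmul m n

theorem BTensor.hom_ext {f g : BTensor M N →ₗ[ℂ] K} (h : ∀ m n, f (m ⊠ n) = g (m ⊠ n)) :
    f = g := by
  refine Submodule.linearMap_qext _ (TensorProduct.ext' fun m n => h m n)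

/-- `(a.m) ⊗ n` as an endomorphism -/
def BTensor.leftEnd (a : A) : BTensor M N →ₗ[ℂ] BTensor M N :=
  BTensor.lift ((tmulₗ M N).comp (Bimodule.left (B := B) a : M →ₗ[ℂ] M)) (by
    intro m b n
    change (a ▷ (m ◁ b)) ⊠ n = (a ▷ m) ⊠ (b ▷ n)
    rw [lact_ract, tmul_balanced])

/-- `m ⊗ (n.c)` as an endomorphism -/
def BTensor.rightEnd (c : Cᵐᵒᵖ) : BTensor M N →ₗ[ℂ] BTensor M N :=
  BTensor.lift ((tmulₗ M N).compl₂ (Bimodule.right (A := B) c : N →ₗ[ℂ] N)) (by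
    intro m b n
    change (m ◁ b) ⊠ (n ◁ c.unop) = m ⊠ ((b ▷ n) ◁ c.unop)
    rw [← lact_ract, tmul_balanced])

theorem BTensor.leftEnd_tmul (a : A) (m : M) (n : N) :
    BTensor.leftEnd a (m ⊠ n) = (a ▷ m) ⊠ n := BTensor.lift_tmul _ _ _ _

theorem BTensor.rightEnd_tmul (c : Cᵐᵒᵖ) (m : M) (n : N) :
    BTensor.rightEnd c (m ⊠ n) = m ⊠ (n ◁ c.unop) := BTensor.lift_tmul _ _ _ _

/-- `M ⊗_B N` is an `A`-`C`-bimodule by `a.(m ⊗ n).c = (a.m) ⊗ (n.c)`. -/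
instance : Bimodule A C (BTensor M N) where
  left := AlgHom.ofLinearMap
    { toFun := BTensor.leftEnd
      map_add' := fun a a' => BTensor.hom_ext fun m n => by
        simp only [LinearMap.add_apply, BTensor.leftEnd_tmul, add_lact, add_tmul]
      map_smul' := fun c a => BTensor.hom_ext fun m n => by
        simp only [LinearMap.smul_apply, BTensor.leftEnd_tmul, smul_lact, smul_tmul,
          RingHom.id_apply] }
    (BTensor.hom_ext fun m n => by
      change BTensor.leftEnd 1 (m ⊠ n) = m ⊠ n
      simp only [BTensor.leftEnd_tmul, one_lact])
    (fun a a' => BTensor.hom_ext fun m n => by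
      change BTensor.leftEnd (a * a') (m ⊠ n) = BTensor.leftEnd a (BTensor.leftEnd a' (m ⊠ n))
      simp only [BTensor.leftEnd_tmul, mul_lact])
  right := AlgHom.ofLinearMap
    { toFun := BTensor.rightEnd
      map_add' := fun a a' => BTensor.hom_ext fun m n => by
        simp only [LinearMap.add_apply, BTensor.rightEnd_tmul, MulOpposite.unop_add, ract_add,
          tmul_add]
      map_smul' := fun c a => BTensor.hom_ext fun m n => by
        simp only [LinearMap.smul_apply, BTensor.rightEnd_tmul, MulOpposite.unop_smul, ract_smul,
          tmul_smul, RingHom.id_apply] }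
    (BTensor.hom_ext fun m n => by
      change BTensor.rightEnd 1 (m ⊠ n) = m ⊠ n
      simp only [BTensor.rightEnd_tmul, MulOpposite.unop_one, ract_one])
    (fun a a' => BTensor.hom_ext fun m n => by
      change BTensor.rightEnd (a * a') (m ⊠ n) = BTensor.rightEnd a (BTensor.rightEnd a' (m ⊠ n))
      simp only [BTensor.rightEnd_tmul, MulOpposite.unop_mul, ract_mul])
  left_right := fun a c z => by
    have : (BTensor.leftEnd a).comp (BTensor.rightEnd c)
        = (BTensor.rightEnd c).comp (BTensor.leftEnd (M := M) (N := N) a) :=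
      BTensor.hom_ext fun m n => by
        simp only [LinearMap.comp_apply, BTensor.leftEnd_tmul, BTensor.rightEnd_tmul]
    exact LinearMap.congr_fun this z

theorem lact_tmul (a : A) (m : M) (n : N) : a ▷ (m ⊠ n) = (a ▷ m) ⊠ n :=
  BTensor.leftEnd_tmul a m n

theorem tmul_ract (m : M) (n : N) (c : C) : (m ⊠ n) ◁ c = m ⊠ (n ◁ c) :=
  BTensor.rightEnd_tmul (op c) m n

/-- `f ⊗ id : M ⊗_B N → M' ⊗_B N` for a right `B`-module map `f`. -/
def BTensor.mapLeft {M' : Type} [AddCommGroup M'] [Module ℂ M'] [Bimodule D B M']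
    (f : M →ₗ[ℂ] M') (hf : ∀ (m : M) (b : B), f (m ◁ b) = f m ◁ b) :
    BTensor M N →ₗ[ℂ] BTensor M' N :=
  BTensor.lift ((tmulₗ M' N).comp f) (by
    intro m b n
    change f (m ◁ b) ⊠ n = f m ⊠ (b ▷ n)
    rw [hf, tmul_balanced])

variable [Bimodule C D K]

/-- `n ⊗ k ↦ (m ⊗ n) ⊗ k` -/
def BTensor.reassocAux (K : Type) [AddCommGroup K] [Module ℂ K] [Bimodule C D K] (m : M) :
    BTensor N K →ₗ[ℂ] BTensor (BTensor M N) K :=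
  BTensor.lift ((tmulₗ (BTensor M N) K).comp (tmulₗ M N m)) (by
    intro n c k
    change (m ⊠ (n ◁ c)) ⊠ k = (m ⊠ n) ⊠ (c ▷ k)
    rw [← tmul_ract, tmul_balanced])

theorem BTensor.reassocAux_tmul (m : M) (n : N) (k : K) :
    BTensor.reassocAux K m (n ⊠ k) = (m ⊠ n) ⊠ k := BTensor.lift_tmul _ _ _ _

/-- `n ⊗ k ↦ (m ⊗ n) ⊗ k`, linearly in `m` -/
def BTensor.reassocₗ (M N K : Type) [AddCommGroup M] [Module ℂ M] [AddCommGroup N] [Module ℂ N]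
    [AddCommGroup K] [Module ℂ K] [Bimodule A B M] [Bimodule B C N] [Bimodule C D K] :
    M →ₗ[ℂ] BTensor N K →ₗ[ℂ] BTensor (BTensor M N) K where
  toFun m := BTensor.reassocAux K m
  map_add' m m' := BTensor.hom_ext fun n k => by
    simp only [LinearMap.add_apply, BTensor.reassocAux_tmul, add_tmul]
  map_smul' c m := BTensor.hom_ext fun n k => by
    simp only [RingHom.id_apply, LinearMap.smul_apply, BTensor.reassocAux_tmul, smul_tmul]

/-- The identification `M ⊗_B (N ⊗_C K) → (M ⊗_B N) ⊗_C K`, `m ⊗ (n ⊗ k) ↦ (m ⊗ n) ⊗ k`. -/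
def BTensor.reassoc (M N K : Type) [AddCommGroup M] [Module ℂ M] [AddCommGroup N] [Module ℂ N]
    [AddCommGroup K] [Module ℂ K] [Bimodule A B M] [Bimodule B C N] [Bimodule C D K] :
    BTensor M (BTensor N K) →ₗ[ℂ] BTensor (BTensor M N) K :=
  BTensor.lift (BTensor.reassocₗ M N K) (by
      intro m b z
      have : BTensor.reassocAux K (m ◁ b)
          = (BTensor.reassocAux K m).comp (Bimodule.left (B := D) (M := BTensor N K) b) :=
        BTensor.hom_ext fun n k => by
          change _ = BTensor.reassocAux K m (b ▷ (n ⊠ k))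
          rw [lact_tmul, BTensor.reassocAux_tmul, BTensor.reassocAux_tmul, tmul_balanced]
      exact LinearMap.congr_fun this z)

theorem BTensor.reassoc_tmul (m : M) (n : N) (k : K) :
    BTensor.reassoc M N K (m ⊠ (n ⊠ k)) = (m ⊠ n) ⊠ k := by
  refine (BTensor.lift_tmul (BTensor.reassocₗ M N K) _ m (n ⊠ k)).trans ?_
  exact BTensor.reassocAux_tmul m n k

end tensor

/-! ## Differential calculi, bimodule connections, and the covariant derivative of a map -/

/-- A first order differential calculus `(Ω, d)` on `A`. -/
structure Calculus (A Ω : Type) [Ring A] [Algebra ℂ A] [AddCommGroup Ω] [Module ℂ Ω]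
    [Bimodule A A Ω] where
  d : A →ₗ[ℂ] Ω
  leibniz : ∀ a b : A, d (a * b) = d a ◁ b + a ▷ d b

variable {ΩA ΩB ΩC : Type} [AddCommGroup ΩA] [Module ℂ ΩA] [Bimodule A A ΩA]
  [AddCommGroup ΩB] [Module ℂ ΩB] [Bimodule B B ΩB]
  [AddCommGroup ΩC] [Module ℂ ΩC] [Bimodule C C ΩC]

/-- A right `A`-`B`-bimodule connection `∇ : E → E ⊗_B Ω_B` together with its generalised
braiding, a bimodule map `σ : Ω_A ⊗_A E → E ⊗_B Ω_B`. -/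
structure BimoduleConnection (dA : Calculus A ΩA) (dB : Calculus B ΩB)
    (E : Type) [AddCommGroup E] [Module ℂ E] [Bimodule A B E] where
  nabla : E →ₗ[ℂ] BTensor E ΩB
  sigma : BTensor ΩA E →ₗ[ℂ] BTensor E ΩB
  sigma_left : ∀ (a : A) (z : BTensor ΩA E), sigma (a ▷ z) = a ▷ sigma z
  sigma_right : ∀ (z : BTensor ΩA E) (b : B), sigma (z ◁ b) = sigma z ◁ b
  right_leibniz : ∀ (e : E) (b : B), nabla (e ◁ b) = nabla e ◁ b + e ⊠ dB.d b
  left_leibniz : ∀ (a : A) (e : E), nabla (a ▷ e) = a ▷ nabla e + sigma (dA.d a ⊠ e)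

variable {E F : Type} [AddCommGroup E] [Module ℂ E] [Bimodule A B E]
  [AddCommGroup F] [Module ℂ F] [Bimodule B C F]
variable {dA : Calculus A ΩA} {dB : Calculus B ΩB} {dC : Calculus C ΩC}

/-- `x ⊗ f ↦ (id ⊗ σ_F)(x ⊗ f)` for `x ∈ E ⊗_B Ω_B` and `f ∈ F`. -/
def idSigma (E : Type) [AddCommGroup E] [Module ℂ E] [Bimodule A B E]
    (cF : BimoduleConnection dB dC F) (f : F) :
    BTensor E ΩB →ₗ[ℂ] BTensor (BTensor E F) ΩC :=
  (BTensor.reassoc E F ΩC).comp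
    (BTensor.lift ((tmulₗ E (BTensor F ΩC)).compl₂ (cF.sigma.comp ((tmulₗ ΩB F).flip f))) (by
      intro e b w
      change (e ◁ b) ⊠ cF.sigma (w ⊠ f) = e ⊠ cF.sigma ((b ▷ w) ⊠ f)
      rw [tmul_balanced, ← cF.sigma_left, lact_tmul]))

theorem idSigma_tmul (cF : BimoduleConnection dB dC F) (e : E) (w : ΩB) (f : F) :
    idSigma E cF f (e ⊠ w) = BTensor.reassoc E F ΩC (e ⊠ cF.sigma (w ⊠ f)) := by
  rw [idSigma, LinearMap.comp_apply, BTensor.lift_tmul]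
  rfl

theorem idSigma_ract (cF : BimoduleConnection dB dC F) (x : BTensor E ΩB) (b : B) (f : F) :
    idSigma E cF f (x ◁ b) = idSigma E cF (b ▷ f) x := by
  have : (idSigma E cF f).comp (Bimodule.right (A := A) (op b)) = idSigma E cF (b ▷ f) :=
    BTensor.hom_ext fun e w => by
      change idSigma E cF f ((e ⊠ w) ◁ b) = _
      rw [tmul_ract, idSigma_tmul, idSigma_tmul, tmul_balanced]
  exact LinearMap.congr_fun this x

/-- The tensor product connection `(id ⊗ σ_F)(∇_E ⊗ id) + id ⊗ ∇_F` on `E ⊗_B F`. -/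
def tensorNabla (cE : BimoduleConnection dA dB E) (cF : BimoduleConnection dB dC F) :
    BTensor E F →ₗ[ℂ] BTensor (BTensor E F) ΩC :=
  BTensor.lift
    (LinearMap.mk₂ ℂ
      (fun e f => idSigma E cF f (cE.nabla e) + BTensor.reassoc E F ΩC (e ⊠ cF.nabla f))
      (by
        intro e e' f
        rw [map_add, map_add, add_tmul, map_add]
        abel)
      (by
        intro c e f
        rw [map_smul, map_smul, smul_tmul, map_smul, smul_add])
      (by
        intro e f f'
        have : idSigma E cF (f + f') = idSigma E cF f + idSigma E cF f' :=
          BTensor.hom_ext fun e w => by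
            simp only [LinearMap.add_apply, idSigma_tmul, tmul_add, map_add]
        rw [this, LinearMap.add_apply, map_add, tmul_add, map_add]
        abel)
      (by
        intro c e f
        have : idSigma E cF (c • f) = c • idSigma E cF f :=
          BTensor.hom_ext fun e w => by
            simp only [LinearMap.smul_apply, idSigma_tmul, tmul_smul, map_smul]
        rw [this, LinearMap.smul_apply, map_smul, tmul_smul, map_smul, smul_add]))
    (by
      intro e b f
      simp only [LinearMap.mk₂_apply]
      rw [cE.right_leibniz, cF.left_leibniz, map_add, idSigma_ract, idSigma_tmul, tmul_balanced,
        tmul_add, map_add]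
      abel)

theorem tensorNabla_tmul (cE : BimoduleConnection dA dB E) (cF : BimoduleConnection dB dC F)
    (e : E) (f : F) :
    tensorNabla cE cF (e ⊠ f)
      = idSigma E cF f (cE.nabla e) + BTensor.reassoc E F ΩC (e ⊠ cF.nabla f) := by
  rw [tensorNabla, BTensor.lift_tmul, LinearMap.mk₂_apply]

/-- For linear connections on `Ω_A`, `Ω_B` and a bimodule connection on `E`, the covariant
derivative of the braiding,
`∇∇(σ_E) = ∇_{E ⊗_B Ω_B} σ_E - (σ_E ⊗ id) ∇_{Ω_A ⊗_A E}`. -/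
def doubleNabla (cA : BimoduleConnection dA dA ΩA) (cB : BimoduleConnection dB dB ΩB)
    (cE : BimoduleConnection dA dB E) :
    BTensor ΩA E →ₗ[ℂ] BTensor (BTensor E ΩB) ΩB :=
  (tensorNabla cE cB).comp cE.sigma
    - (BTensor.mapLeft cE.sigma cE.sigma_right).comp (tensorNabla cA cE)

end Bimodules

/-! ## The classical calculus on the geodesic parameter line -/

/-- `B = C^∞(ℝ)` -/
def Line : Subalgebra ℂ (ℝ → ℂ) where
  carrier := {b | ContDiff ℝ ∞ b}
  mul_mem' {b c} hb hc := by
    have hb' : ContDiff ℝ ∞ b := hb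
    have hc' : ContDiff ℝ ∞ c := hc
    exact hb'.mul hc'
  add_mem' {b c} hb hc := by
    have hb' : ContDiff ℝ ∞ b := hb
    have hc' : ContDiff ℝ ∞ c := hc
    exact hb'.add hc'
  algebraMap_mem' c := by
    change ContDiff ℝ ∞ (fun _ : ℝ => c)
    exact contDiff_const

/-- `Ω¹_B = C^∞(ℝ) ds`, the element `b` standing for `b ds` -/
def LineForm : Type := Line

instance : AddCommGroup LineForm := inferInstanceAs (AddCommGroup Line)
instance : Module ℂ LineForm := inferInstanceAs (Module ℂ Line)

/-- the one-form `b ds` -/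
def toForm : Line →ₗ[ℂ] LineForm := LinearMap.id (R := ℂ) (M := Line)

/-- the coefficient `b` of `b ds` -/
def coeff : LineForm →ₗ[ℂ] Line := LinearMap.id (R := ℂ) (M := Line)

/-- the basic one-form `ds` -/
def ds : LineForm := toForm 1

theorem toForm_coeff (w : LineForm) : toForm (coeff w) = w := rfl

/-- multiplication of one-forms by functions -/
def formMul : Line →ₐ[ℂ] Module.End ℂ LineForm := Algebra.lmul ℂ Line

theorem formMul_toForm (b c : Line) : formMul b (toForm c) = toForm (b * c) := rfl

instance : Bimodule Line Line LineForm where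
  left := formMul
  right := formMul.comp (AlgEquiv.toOpposite ℂ Line).symm.toAlgHom
  left_right := fun a b m => by
    change formMul a (formMul b.unop m) = formMul b.unop (formMul a m)
    rw [← Module.End.mul_apply, ← Module.End.mul_apply, ← map_mul, ← map_mul, mul_comm]

/-- the derivative of a smooth function on the line -/
def Line.deriv : Line →ₗ[ℂ] Line where
  toFun b := ⟨_root_.deriv b.1, by
    have hb : ContDiff ℝ ∞ b.1 := b.2
    exact (contDiff_infty_iff_deriv.1 hb).2⟩
  map_add' b c := by
    have hb : ContDiff ℝ ∞ b.1 := b.2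
    have hc : ContDiff ℝ ∞ c.1 := c.2
    ext s
    exact deriv_add (hb.differentiable (by simp) s) (hc.differentiable (by simp) s)
  map_smul' c b := by
    have hb : ContDiff ℝ ∞ b.1 := b.2
    ext s
    exact deriv_const_smul c (hb.differentiable (by simp) s)

theorem Line.deriv_mul (b c : Line) : Line.deriv (b * c) = Line.deriv b * c + b * Line.deriv c := by
  have hb : ContDiff ℝ ∞ b.1 := b.2
  have hc : ContDiff ℝ ∞ c.1 := c.2
  ext s
  exact _root_.deriv_mul (hb.differentiable (by simp) s) (hc.differentiable (by simp) s)

theorem lact_toForm (b c : Line) : b ▷ toForm c = toForm (b * c) := rfl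
theorem toForm_ract (b c : Line) : toForm c ◁ b = toForm (b * c) := rfl

/-- the classical calculus `db = b' ds` -/
def lineCalculus : Calculus Line LineForm where
  d := toForm.comp Line.deriv
  leibniz b c := by
    simp only [LinearMap.comp_apply, Line.deriv_mul, lact_toForm, toForm_ract, map_add]
    rw [mul_comm c]

/-- The trivial linear connection on `Ω¹_B`: `∇ (b ds) = db ⊗ ds`, with `σ = id`. -/
def lineConnection : BimoduleConnection lineCalculus lineCalculus LineForm where
  nabla := ((tmulₗ LineForm LineForm).flip ds).comp (lineCalculus.d.comp coeff)
  sigma := LinearMap.id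
  sigma_left _ _ := rfl
  sigma_right _ _ := rfl
  right_leibniz := by
    intro w b
    let c : Line := coeff w
    change toForm (Line.deriv (b * c)) ⊠ ds
      = (toForm (Line.deriv c) ⊠ ds) ◁ b + toForm c ⊠ toForm (Line.deriv b)
    have h1 : ds ◁ b = b ▷ ds := rfl
    have h2 : toForm (Line.deriv b) = Line.deriv b ▷ ds := by rw [ds, lact_toForm, mul_one]
    rw [tmul_ract, h1, h2, ← tmul_balanced, ← tmul_balanced, ← add_tmul, toForm_ract, toForm_ract,
      ← map_add, Line.deriv_mul, add_comm]
  left_leibniz := by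
    intro b w
    let c : Line := coeff w
    change toForm (Line.deriv (b * c)) ⊠ ds
      = b ▷ (toForm (Line.deriv c) ⊠ ds) + toForm (Line.deriv b) ⊠ toForm c
    have h2 : toForm c = c ▷ ds := by rw [ds, lact_toForm, mul_one]
    rw [lact_tmul, h2, ← tmul_balanced, ← add_tmul, toForm_ract, lact_toForm, ← map_add,
      Line.deriv_mul, add_comm, mul_comm c]

/-! ## The electromagnetic Heisenberg algebra -/

/-- points `(x⁰, x¹, x², x³)` of spacetime -/
abbrev Spacetime : Type := Fin 4 → ℝ

/-- `η = diag(-1, 1, 1, 1)` -/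
def eta (a b : Fin 4) : ℂ := if a = b then (if a = 0 then -1 else 1) else 0

/-- `∂f/∂x^a` -/
def pdFun (a : Fin 4) (f : Spacetime → ℂ) : Spacetime → ℂ :=
  fun x => fderiv ℝ f x (Pi.single a 1)

/-- `F_{ab} = A_{b,a} - A_{a,b}` -/
def faraday (pot : Fin 4 → Spacetime → ℝ) (a b : Fin 4) : Spacetime → ℂ :=
  fun x => pdFun a (fun y => (pot b y : ℂ)) x - pdFun b (fun y => (pot a y : ℂ)) x

/-- Physical constants, a smooth real gauge potential, and the algebra `fn` of those functions of
the `x^a` that are admitted in the Heisenberg algebra: any algebra of smooth functions which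
contains the coordinates and the field strength and is closed under partial derivatives. Both
the full algebra `C^∞(ℝ⁴)` and the algebra generated by the `x^a` and all derivatives of
the `F_{ab}` are possible. -/
structure Background where
  hbar : ℝ
  q : ℝ
  m : ℝ
  hbar_ne : hbar ≠ 0
  m_ne : m ≠ 0
  pot : Fin 4 → Spacetime → ℝ
  pot_smooth : ∀ a, ContDiff ℝ ∞ (pot a)
  fn : Subalgebra ℂ (Spacetime → ℂ)
  fn_smooth : ∀ f ∈ fn, ContDiff ℝ ∞ f
  fn_coord : ∀ a : Fin 4, (fun x : Spacetime => (x a : ℂ)) ∈ fn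
  fn_pd : ∀ f ∈ fn, ∀ a, pdFun a f ∈ fn
  fn_faraday : ∀ a b, faraday pot a b ∈ fn

variable (P : Background)

namespace Background

/-- `ħ`, `q`, `m` as complex numbers -/
def ħ : ℂ := P.hbar
def qc : ℂ := P.q
def mc : ℂ := P.m

/-- the type of admitted functions of the `x^a` -/
abbrev Fn : Type := P.fn

/-- the coordinate function `x^a` -/
def coord (a : Fin 4) : P.Fn := ⟨_, P.fn_coord a⟩

/-- `f_{,a}` -/
def pd (a : Fin 4) (f : P.Fn) : P.Fn := ⟨pdFun a f.1, P.fn_pd f.1 f.2 a⟩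

/-- `F_{ab}` -/
def F (a b : Fin 4) : P.Fn := ⟨faraday P.pot a b, P.fn_faraday a b⟩

/-- `F_{ab,c}` -/
def F1 (a b c : Fin 4) : P.Fn := P.pd c (P.F a b)

/-- `F_{ab,cd}` -/
def F2 (a b c d : Fin 4) : P.Fn := P.pd d (P.F1 a b c)

/-- `F_{ab,cde}` -/
def F3 (a b c d e : Fin 4) : P.Fn := P.pd e (P.F2 a b c d)

end Background

open Complex (I)
open Background

/-- The relations of the electromagnetic Heisenberg algebra on generators `f` (functions of the
`x^a`) and `p_a`: the functions multiply and add as functions, `[f, p_a] = iħ f_{,a}` (in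
particular `[x^a, p_b] = iħ δ^a_b`) and `[p_a, p_b] = iħ q F_{ab}`. -/
inductive HeisRel : FreeAlgebra ℂ (P.Fn ⊕ Fin 4) → FreeAlgebra ℂ (P.Fn ⊕ Fin 4) → Prop
  | fn_add (f g : P.Fn) : HeisRel (FreeAlgebra.ι ℂ (Sum.inl (f + g)))
      (FreeAlgebra.ι ℂ (Sum.inl f) + FreeAlgebra.ι ℂ (Sum.inl g))
  | fn_mul (f g : P.Fn) : HeisRel (FreeAlgebra.ι ℂ (Sum.inl (f * g)))
      (FreeAlgebra.ι ℂ (Sum.inl f) * FreeAlgebra.ι ℂ (Sum.inl g))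
  | fn_const (c : ℂ) : HeisRel (FreeAlgebra.ι ℂ (Sum.inl (algebraMap ℂ P.Fn c)))
      (algebraMap ℂ _ c)
  | fn_p (f : P.Fn) (a : Fin 4) : HeisRel
      (FreeAlgebra.ι ℂ (Sum.inl f) * FreeAlgebra.ι ℂ (Sum.inr a)
        - FreeAlgebra.ι ℂ (Sum.inr a) * FreeAlgebra.ι ℂ (Sum.inl f))
      ((I * P.ħ) • FreeAlgebra.ι ℂ (Sum.inl (P.pd a f)))
  | p_p (a b : Fin 4) : HeisRel
      (FreeAlgebra.ι ℂ (Sum.inr a) * FreeAlgebra.ι ℂ (Sum.inr b)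
        - FreeAlgebra.ι ℂ (Sum.inr b) * FreeAlgebra.ι ℂ (Sum.inr a))
      ((I * P.ħ * P.qc) • FreeAlgebra.ι ℂ (Sum.inl (P.F a b)))

/-- The electromagnetic Heisenberg algebra. -/
def Heis : Type := RingQuot (HeisRel P)

instance : Ring (Heis P) := inferInstanceAs (Ring (RingQuot (HeisRel P)))
instance : Algebra ℂ (Heis P) := inferInstanceAs (Algebra ℂ (RingQuot (HeisRel P)))

variable {P}

/-- a function of the `x^a` as an element of the Heisenberg algebra -/
def fnH (f : P.Fn) : Heis P :=
  RingQuot.mkAlgHom ℂ (HeisRel P) (FreeAlgebra.ι ℂ (Sum.inl f))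

variable (P)

/-- the generator `x^a` -/
def xH (a : Fin 4) : Heis P := fnH (P.coord a)

/-- the generator `p_a` -/
def pH (a : Fin 4) : Heis P :=
  RingQuot.mkAlgHom ℂ (HeisRel P) (FreeAlgebra.ι ℂ (Sum.inr a))

/-! ## The centrally extended calculus -/

/-- symbols for the generators of `Ω¹` as a bimodule: `da` for each `a`, and `θ'` -/
inductive FormGen : Type
  | d (a : Heis P) : FormGen
  | theta : FormGen

/-- the enveloping algebra `A ⊗ A^op`, whose left modules are the `A`-bimodules -/
def Env : Type := Heis P ⊗[ℂ] (Heis P)ᵐᵒᵖ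

instance : Ring (Env P) := inferInstanceAs (Ring (Heis P ⊗[ℂ] (Heis P)ᵐᵒᵖ))
instance : Algebra ℂ (Env P) := inferInstanceAs (Algebra ℂ (Heis P ⊗[ℂ] (Heis P)ᵐᵒᵖ))

/-- `a ↦ a ⊗ 1` -/
def envL : Heis P →ₐ[ℂ] Env P :=
  (Algebra.TensorProduct.includeLeft : Heis P →ₐ[ℂ] Heis P ⊗[ℂ] (Heis P)ᵐᵒᵖ)

/-- `b ↦ 1 ⊗ b` -/
def envR : (Heis P)ᵐᵒᵖ →ₐ[ℂ] Env P :=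
  (Algebra.TensorProduct.includeRight : (Heis P)ᵐᵒᵖ →ₐ[ℂ] Heis P ⊗[ℂ] (Heis P)ᵐᵒᵖ)

theorem envL_mul_envR (a : Heis P) (b : (Heis P)ᵐᵒᵖ) :
    envL P a * envR P b = envR P b * envL P a := by
  change (a ⊗ₜ[ℂ] (1 : (Heis P)ᵐᵒᵖ)) * ((1 : Heis P) ⊗ₜ[ℂ] b)
    = ((1 : Heis P) ⊗ₜ[ℂ] b) * (a ⊗ₜ[ℂ] (1 : (Heis P)ᵐᵒᵖ))
  rw [Algebra.TensorProduct.tmul_mul_tmul, Algebra.TensorProduct.tmul_mul_tmul]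
  simp

/-- The free `A`-bimodule on these symbols, i.e. the free `A ⊗ A^op`-module. -/
abbrev FreeForm : Type := FormGen P →₀ Env P

variable {P}

/-- the symbol `da` -/
def symD (a : Heis P) : FreeForm P := Finsupp.single (FormGen.d a) 1

variable (P)

/-- the symbol `θ'` -/
def symTheta : FreeForm P := Finsupp.single FormGen.theta 1

variable {P}

/-- `a.ξ` in the free bimodule -/
def freeL (a : Heis P) (ξ : FreeForm P) : FreeForm P := envL P a • ξ

/-- `ξ.a` in the free bimodule -/
def freeR (ξ : FreeForm P) (a : Heis P) : FreeForm P := envR P (op a) • ξ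

/-- `[ξ, a] = ξ.a - a.ξ` in the free bimodule -/
def freeComm (ξ : FreeForm P) (a : Heis P) : FreeForm P := freeR ξ a - freeL a ξ

variable (P)

/-- The relations (elements set to zero) of the calculus: linearity and the Leibniz rule for `d`,
centrality of `θ'`, and the commutation relations of the calculus. -/
inductive FormRel : FreeForm P → Prop
  | d_add (a b : Heis P) : FormRel (symD (a + b) - (symD a + symD b))
  | d_smul (c : ℂ) (a : Heis P) : FormRel (symD (c • a) - c • symD a)
  | leibniz (a b : Heis P) : FormRel (symD (a * b) - (freeR (symD a) b + freeL a (symD b)))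
  | theta_central (a : Heis P) : FormRel (freeComm (symTheta P) a)
  /-- `df = f_{,a} dx^a - (iħ/2m) η^{ab} f_{,ab} θ'` -/
  | d_fn (f : P.Fn) : FormRel (symD (fnH f)
      - (∑ a, freeL (fnH (P.pd a f)) (symD (xH P a))
        - (I * P.ħ / (2 * P.mc)) •
            ∑ a, ∑ b, eta a b • freeL (fnH (P.pd b (P.pd a f))) (symTheta P)))
  /-- `[dx^a, f] = -(iħ/m) η^{ab} f_{,b} θ'`, so `[dx^a, x^b] = -(iħ/m) η^{ab} θ'` -/
  | dx_fn (a : Fin 4) (f : P.Fn) : FormRel (freeComm (symD (xH P a)) (fnH f)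
      - (-(I * P.ħ / P.mc)) • ∑ b, eta a b • freeL (fnH (P.pd b f)) (symTheta P))
  /-- `[dx^a, p_c] = (iħq/m) η^{ab} F_{bc} θ'` -/
  | dx_p (a c : Fin 4) : FormRel (freeComm (symD (xH P a)) (pH P c)
      - (I * P.ħ * P.qc / P.mc) • ∑ b, eta a b • freeL (fnH (P.F b c)) (symTheta P))
  /-- `[dp_c, f] = (iħq/m) η^{ab} F_{bc} f_{,a} θ'`, so
  `[dp_c, x^a] = (iħq/m) η^{ab} F_{bc} θ'` -/
  | dp_fn (c : Fin 4) (f : P.Fn) : FormRel (freeComm (symD (pH P c)) (fnH f)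
      - (I * P.ħ * P.qc / P.mc) •
          ∑ a, ∑ b, eta a b • freeL (fnH (P.F b c * P.pd a f)) (symTheta P))
  /-- `[dp_c, p_d] = -iħq F_{ac,d} dx^a
    - (ħq/2m) η^{ab} (ħ F_{bc,ad} + 2iq F_{ac} F_{bd}) θ'` -/
  | dp_p (c d : Fin 4) : FormRel (freeComm (symD (pH P c)) (pH P d)
      - ((-(I * P.ħ * P.qc)) • ∑ a, freeL (fnH (P.F1 a c d)) (symD (xH P a))
        - (P.ħ * P.qc / (2 * P.mc)) • ∑ a, ∑ b, eta a b •
            freeL (fnH (P.ħ • P.F2 b c a d + (2 * I * P.qc) • (P.F a c * P.F b d)))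
              (symTheta P)))

/-- the sub-bimodule generated by the relations -/
def formRelations : Submodule (Env P) (FreeForm P) :=
  Submodule.span _ {ξ | FormRel P ξ}

/-- The bimodule `Ω¹` of one-forms on the electromagnetic Heisenberg algebra. -/
def Form : Type := FreeForm P ⧸ formRelations P

instance : AddCommGroup (Form P) := inferInstanceAs (AddCommGroup (FreeForm P ⧸ formRelations P))
instance : Module (Env P) (Form P) :=
  inferInstanceAs (Module _ (FreeForm P ⧸ formRelations P))
instance : Module ℂ (Form P) := inferInstanceAs (Module ℂ (FreeForm P ⧸ formRelations P))
instance : IsScalarTower ℂ (Env P) (Form P) :=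
  inferInstanceAs (IsScalarTower ℂ _ (FreeForm P ⧸ formRelations P))

instance : Bimodule (Heis P) (Heis P) (Form P) where
  left := (Algebra.lsmul ℂ ℂ (Form P)).comp (envL P)
  right := (Algebra.lsmul ℂ ℂ (Form P)).comp (envR P)
  left_right a b ξ := by
    change envL P a • envR P b • ξ = envR P b • envL P a • ξ
    rw [smul_smul, smul_smul, envL_mul_envR]

/-- the class of an element of the free bimodule -/
def toΩ (ξ : FreeForm P) : Form P := (formRelations P).mkQ ξ

theorem toΩ_eq {ξ ζ : FreeForm P} (h : FormRel P (ξ - ζ)) : toΩ P ξ = toΩ P ζ :=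
  (Submodule.Quotient.eq _).2 (Submodule.subset_span h)

/-- the differential calculus `d : A → Ω¹` -/
def heisCalculus : Calculus (Heis P) (Form P) where
  d :=
    { toFun := fun a => toΩ P (symD a)
      map_add' := fun a b => toΩ_eq P (FormRel.d_add a b)
      map_smul' := fun c a => toΩ_eq P (FormRel.d_smul c a) }
  leibniz a b := toΩ_eq P (FormRel.leibniz a b)

/-- the central one-form `θ'` -/
def θ : Form P := toΩ P (symTheta P)

/-- `dx^a` -/
def dx (a : Fin 4) : Form P := (heisCalculus P).d (xH P a)

/-- `dp_a` -/
def dp (a : Fin 4) : Form P := (heisCalculus P).d (pH P a)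

/-! ## The Schrödinger representation and the Klein–Gordon connection -/

/-- `D_a φ = ∂φ/∂x^a - i (q/ħ) A_a φ` for a function `φ(s, x)` -/
def covD (a : Fin 4) (φ : ℝ × Spacetime → ℂ) : ℝ × Spacetime → ℂ :=
  fun z => fderiv ℝ φ z (0, Pi.single a 1) - I * (P.qc / P.ħ) * (P.pot a z.2 : ℂ) * φ z

/-- `∂φ/∂s` -/
def timeD (φ : ℝ × Spacetime → ℂ) : ℝ × Spacetime → ℂ :=
  fun z => fderiv ℝ φ z (1, 0)

/-- A common invariant domain for the operators of the theory: a space `E` of `s`-dependent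
complex wave functions `φ(s, x)`, smooth, on which the admitted functions of `x`, the `D_a`,
the functions of `s` and `∂/∂s` all act. -/
structure StateSpace where
  space : Submodule ℂ (ℝ × Spacetime → ℂ)
  smooth : ∀ φ ∈ space, ContDiff ℝ ∞ φ
  fn_mul : ∀ f ∈ P.fn, ∀ φ ∈ space, (fun z => f z.2 * φ z) ∈ space
  covD_mem : ∀ a, ∀ φ ∈ space, covD P a φ ∈ space
  time_mul : ∀ b ∈ Line, ∀ φ ∈ space, (fun z => b z.1 * φ z) ∈ space
  timeD_mem : ∀ φ ∈ space, timeD φ ∈ space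

namespace StateSpace

variable {P} (E : StateSpace P)

theorem diff (φ : E.space) : Differentiable ℝ φ.1 :=
  (E.smooth φ.1 φ.2).differentiable (by simp)

/-- multiplication by a function of `x` -/
def mulFn (f : P.Fn) : Module.End ℂ E.space where
  toFun φ := ⟨fun z => f.1 z.2 * φ.1 z, E.fn_mul f.1 f.2 φ.1 φ.2⟩
  map_add' φ ψ := by ext z; exact mul_add _ _ _
  map_smul' c φ := by ext z; exact mul_left_comm _ _ _

/-- multiplication by a function of `s` -/
def mulLine (b : Line) : Module.End ℂ E.space where
  toFun φ := ⟨fun z => b.1 z.1 * φ.1 z, E.time_mul b.1 b.2 φ.1 φ.2⟩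
  map_add' φ ψ := by ext z; exact mul_add _ _ _
  map_smul' c φ := by ext z; exact mul_left_comm _ _ _

/-- `D_a` as an operator -/
def D (a : Fin 4) : Module.End ℂ E.space where
  toFun φ := ⟨covD P a φ.1, E.covD_mem a φ.1 φ.2⟩
  map_add' φ ψ := by
    ext z
    change covD P a (φ.1 + ψ.1) z = covD P a φ.1 z + covD P a ψ.1 z
    simp only [covD, fderiv_add (E.diff φ z) (E.diff ψ z), add_apply,
      Pi.add_apply]
    ring
  map_smul' c φ := by
    ext z
    change covD P a (c • φ.1) z = c * covD P a φ.1 z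
    simp only [covD, fderiv_const_smul (E.diff φ z), smul_apply,
      Pi.smul_apply, smul_eq_mul]
    ring

/-- `∂/∂s` as an operator -/
def dds : Module.End ℂ E.space where
  toFun φ := ⟨timeD φ.1, E.timeD_mem φ.1 φ.2⟩
  map_add' φ ψ := by
    ext z
    change timeD (φ.1 + ψ.1) z = timeD φ.1 z + timeD ψ.1 z
    simp only [timeD, fderiv_add (E.diff φ z) (E.diff ψ z), add_apply]
  map_smul' c φ := by
    ext z
    change timeD (c • φ.1) z = c * timeD φ.1 z
    simp only [timeD, fderiv_const_smul (E.diff φ z), smul_apply,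
      smul_eq_mul]

theorem fderiv_snd_dir (g : Spacetime → ℂ) (hg : Differentiable ℝ g) (z : ℝ × Spacetime)
    (a : Fin 4) :
    fderiv ℝ (fun z : ℝ × Spacetime => g z.2) z (0, Pi.single a 1) = pdFun a g z.2 := by
  have h : HasFDerivAt (fun z : ℝ × Spacetime => g z.2)
      ((fderiv ℝ g z.2).comp (ContinuousLinearMap.snd ℝ ℝ Spacetime)) z :=
    (hg z.2).hasFDerivAt.comp z hasFDerivAt_snd
  rw [h.fderiv]
  rfl

theorem covD_mul (a : Fin 4) (g : Spacetime → ℂ) (hg : Differentiable ℝ g)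
    (φ : ℝ × Spacetime → ℂ) (hφ : Differentiable ℝ φ) (z : ℝ × Spacetime) :
    covD P a (fun z => g z.2 * φ z) z = g z.2 * covD P a φ z + pdFun a g z.2 * φ z := by
  have hg' : Differentiable ℝ (fun z : ℝ × Spacetime => g z.2) := hg.comp differentiable_snd
  have := fderiv_fun_mul (hg' z) (hφ z)
  simp only [covD, this, add_apply, smul_apply,
    smul_eq_mul, fderiv_snd_dir g hg]
  ring

theorem D_comm (a b : Fin 4) (φ : E.space) :
    E.D a (E.D b φ) - E.D b (E.D a φ) = (-(I * (P.qc / P.ħ))) • E.mulFn (P.F a b) φ := by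
  ext z
  have hφ := E.smooth φ.1 φ.2
  have hA : ∀ c, ContDiff ℝ ∞ (fun y => (P.pot c y : ℂ)) := fun c =>
    Complex.ofRealCLM.contDiff.comp (P.pot_smooth c)
  have hAd : ∀ c, Differentiable ℝ (fun y => (P.pot c y : ℂ)) := fun c =>
    (hA c).differentiable (by simp)
  have hAs : ∀ c, Differentiable ℝ (fun z : ℝ × Spacetime => (P.pot c z.2 : ℂ)) := fun c =>
    (hAd c).comp differentiable_snd
  have h2 : ∀ v w : ℝ × Spacetime, fderiv ℝ (fun y => fderiv ℝ φ.1 y v) z w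
      = fderiv ℝ (fderiv ℝ φ.1) z w v := by
    intro v w
    have hd : DifferentiableAt ℝ (fderiv ℝ φ.1) z :=
      ((hφ.fderiv_right (m := ∞) (by simp)).differentiable (by simp)) z
    rw [fderiv_clm_apply hd (differentiableAt_const v)]
    simp
  have hsym : ∀ v w : ℝ × Spacetime, fderiv ℝ (fderiv ℝ φ.1) z w v
      = fderiv ℝ (fderiv ℝ φ.1) z v w := fun v w =>
    (hφ.contDiffAt.isSymmSndFDerivAt (by
      rw [minSmoothness_of_isRCLikeNormedField]; exact ENat.LEInfty.out)) w v
  have hcov : ∀ c d : Fin 4, covD P c (covD P d φ.1) z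
      = fderiv ℝ (fderiv ℝ φ.1) z (0, Pi.single c 1) (0, Pi.single d 1)
        - I * (P.qc / P.ħ) * (pdFun c (fun y => (P.pot d y : ℂ)) z.2 * φ.1 z
            + (P.pot d z.2 : ℂ) * fderiv ℝ φ.1 z (0, Pi.single c 1))
        - I * (P.qc / P.ħ) * (P.pot c z.2 : ℂ) * covD P d φ.1 z := by
    intro c d
    have hd1 : DifferentiableAt ℝ (fun y => fderiv ℝ φ.1 y (0, Pi.single d 1)) z :=
      (((hφ.fderiv_right (m := ∞) (by simp)).clm_apply contDiff_const).differentiable (by simp)) z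
    have hd2 : DifferentiableAt ℝ (fun z : ℝ × Spacetime => (P.pot d z.2 : ℂ) * φ.1 z) z :=
      ((hAs d) z).mul (E.diff φ z)
    have he : covD P d φ.1 = fun y => fderiv ℝ φ.1 y (0, Pi.single d 1)
        - (I * (P.qc / P.ħ)) * ((P.pot d y.2 : ℂ) * φ.1 y) := by
      funext y
      simp only [covD]
      ring
    rw [covD, he, fderiv_fun_sub hd1 (hd2.const_mul _), fderiv_const_mul hd2,
      fderiv_fun_mul ((hAs d) z) (E.diff φ z)]
    simp only [sub_apply, add_apply,
      smul_apply, smul_eq_mul, h2, fderiv_snd_dir _ (hAd d)]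
    ring
  change covD P a (covD P b φ.1) z - covD P b (covD P a φ.1) z
    = (-(I * (P.qc / P.ħ))) * (faraday P.pot a b z.2 * φ.1 z)
  rw [hcov, hcov, hsym]
  simp only [covD, faraday]
  ring

theorem ħ_ne : P.ħ ≠ 0 := by
  simp [Background.ħ, P.hbar_ne]

/-- The Schrödinger representation: functions of `x` act by multiplication and
`p_a` acts by `-iħ D_a`. -/
def rep : Heis P →ₐ[ℂ] Module.End ℂ E.space :=
  RingQuot.liftAlgHom ℂ ⟨FreeAlgebra.lift ℂ
    (Sum.elim E.mulFn (fun a => (-(I * P.ħ)) • E.D a)), by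
    intro u v h
    have hI : I * I = -1 := Complex.I_mul_I
    induction h with
    | fn_add f g =>
      simp only [FreeAlgebra.lift_ι_apply, map_add, Sum.elim_inl]
      ext φ z
      exact add_mul _ _ _
    | fn_mul f g =>
      simp only [FreeAlgebra.lift_ι_apply, map_mul, Sum.elim_inl]
      ext φ z
      exact mul_assoc _ _ _
    | fn_const c =>
      simp only [FreeAlgebra.lift_ι_apply, Sum.elim_inl, AlgHom.commutes]
      ext φ z
      rfl
    | fn_p f a =>
      simp only [FreeAlgebra.lift_ι_apply, map_sub, map_mul, map_smul, Sum.elim_inl, Sum.elim_inr]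
      ext φ z
      change f.1 z.2 * ((-(I * P.ħ)) * covD P a φ.1 z)
          - (-(I * P.ħ)) * covD P a (fun z => f.1 z.2 * φ.1 z) z
        = (I * P.ħ) * (pdFun a f.1 z.2 * φ.1 z)
      rw [covD_mul a f.1 ((P.fn_smooth f.1 f.2).differentiable (by simp)) φ.1 (E.diff φ)]
      ring
    | p_p a b =>
      simp only [FreeAlgebra.lift_ι_apply, map_sub, map_mul, map_smul, Sum.elim_inl, Sum.elim_inr]
      apply LinearMap.ext
      intro φ
      have key : ∀ c : ℂ, ((c • E.D a) * (c • E.D b) - (c • E.D b) * (c • E.D a)) φ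
            = (c * c) • (E.D a (E.D b φ) - E.D b (E.D a φ)) := by
        intro c
        simp only [LinearMap.sub_apply, Module.End.mul_apply, LinearMap.smul_apply, map_smul,
          smul_smul, smul_sub]
      have hc : (-(I * P.ħ)) * (-(I * P.ħ)) * (-(I * (P.qc / P.ħ))) = I * P.ħ * P.qc := by
        have h0 := ħ_ne (P := P)
        field_simp
        linear_combination (-P.qc) * hI
      rw [key, D_comm, smul_smul, LinearMap.smul_apply, hc]⟩

theorem rep_mk (u : FreeAlgebra ℂ (P.Fn ⊕ Fin 4)) :
    E.rep (RingQuot.mkAlgHom ℂ (HeisRel P) u) = FreeAlgebra.lift ℂ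
      (Sum.elim E.mulFn (fun a => (-(I * P.ħ)) • E.D a)) u :=
  RingQuot.liftAlgHom_mkAlgHom_apply _ _ _ _

theorem D_mulLine (a : Fin 4) (b : Line) : E.D a * E.mulLine b = E.mulLine b * E.D a := by
  ext φ z
  have hb : Differentiable ℝ b.1 := by
    have h : ContDiff ℝ ∞ b.1 := b.2
    exact h.differentiable (by simp)
  have h : HasFDerivAt (fun z : ℝ × Spacetime => b.1 z.1)
      ((fderiv ℝ b.1 z.1).comp (ContinuousLinearMap.fst ℝ ℝ Spacetime)) z :=
    (hb z.1).hasFDerivAt.comp z hasFDerivAt_fst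
  change covD P a (fun z => b.1 z.1 * φ.1 z) z = b.1 z.1 * covD P a φ.1 z
  have h' : fderiv ℝ (fun z : ℝ × Spacetime => b.1 z.1 * φ.1 z) z = _ :=
    (h.mul (E.diff φ z).hasFDerivAt).fderiv
  simp only [covD, h', add_apply, smul_apply, smul_eq_mul,
    ContinuousLinearMap.comp_apply, ContinuousLinearMap.coe_fst', map_zero]
  ring

theorem rep_mulLine (a : Heis P) (b : Line) :
    E.rep a * E.mulLine b = E.mulLine b * E.rep a := by
  obtain ⟨u, rfl⟩ := RingQuot.mkAlgHom_surjective ℂ (HeisRel P) a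
  rw [rep_mk]
  induction u using FreeAlgebra.induction with
  | grade0 r => rw [AlgHom.commutes]; exact Algebra.commutes _ _
  | grade1 x =>
    rw [FreeAlgebra.lift_ι_apply]
    rcases x with f | c
    · ext φ z
      exact mul_left_comm _ _ _
    · simp only [Sum.elim_inr, smul_mul_assoc, mul_smul_comm, D_mulLine]
  | mul u v hu hv => rw [map_mul, mul_assoc, hv, ← mul_assoc, hu, mul_assoc]
  | add u v hu hv => rw [map_add, add_mul, mul_add, hu, hv]

/-- `E` is an `A`-`B`-bimodule, by the Schrödinger representation and pointwise multiplication
by functions of `s`. -/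
instance : Bimodule (Heis P) Line E.space where
  left := E.rep
  right := (AlgHom.ofLinearMap
    { toFun := E.mulLine
      map_add' := fun b c => by ext φ z; exact add_mul _ _ _
      map_smul' := fun r b => by ext φ z; exact mul_assoc _ _ _ }
    (by ext φ z; exact one_mul _)
    (fun b c => by ext φ z; exact mul_assoc _ _ _)).comp
      (AlgEquiv.toOpposite ℂ Line).symm.toAlgHom
  left_right a b φ := LinearMap.congr_fun (E.rep_mulLine a b.unop) φ

/-- The operator `∂_s - (iħ/2m) η^{ab} D_a D_b`. -/
def kleinGordon : Module.End ℂ E.space :=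
  E.dds - (I * P.ħ / (2 * P.mc)) • ∑ a, ∑ b, eta a b • (E.D a * E.D b)

/-- `∇_E φ = (∂_s φ - (iħ/2m) η^{ab} D_a D_b φ) ⊗ ds` -/
def nablaE : E.space →ₗ[ℂ] BTensor E.space LineForm :=
  ((tmulₗ E.space LineForm).flip ds).comp E.kleinGordon

end StateSpace

/-! ## Coefficients of the connection -/

/-- `X(dp_c) = (q/2m) η^{ab} (2 F_{ca} p_b - iħ F_{cb,a})` -/
def Xdp (c : Fin 4) : Heis P :=
  (P.qc / (2 * P.mc)) • ∑ a, ∑ b, eta a b •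
    ((2 : ℂ) • (fnH (P.F c a) * pH P b) - (I * P.ħ) • fnH (P.F1 c b a))

/-- `N_c = -(iħq²/2m²) η^{nk} η^{ab} (2 F_{an} F_{kc,b} + F_{bn,a} F_{kc})
  + (ħ²q/4m²) η^{nk} η^{ab} F_{bc,ank}` -/
def Ncoef (c : Fin 4) : P.Fn :=
  (-(I * P.ħ * P.qc ^ 2 / (2 * P.mc ^ 2))) • (∑ n, ∑ k, ∑ a, ∑ b, (eta n k * eta a b) •
      ((2 : ℂ) • (P.F a n * P.F1 k c b) + P.F1 b n a * P.F k c))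
    + (P.ħ ^ 2 * P.qc / (4 * P.mc ^ 2)) •
      ∑ n, ∑ k, ∑ a, ∑ b, (eta n k * eta a b) • P.F3 b c a n k

/-- `ξ_c = -(iħq/2m) η^{nk} F_{ac,nk} dx^a` -/
def xiForm (c : Fin 4) : Form P :=
  (-(I * P.ħ * P.qc / (2 * P.mc))) •
    ∑ n, ∑ k, ∑ a, eta n k • (fnH (P.F2 a c n k) ▷ dx P a)

/-- `η_c = -(iħq/2m) η^{nk} F_{nc,ka} dx^a - (q²/m) η^{eb} F_{ec} F_{ab} dx^a` -/
def etaForm (c : Fin 4) : Form P :=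
  (-(I * P.ħ * P.qc / (2 * P.mc))) •
      (∑ n, ∑ k, ∑ a, eta n k • (fnH (P.F2 n c k a) ▷ dx P a))
    - (P.qc ^ 2 / P.mc) •
      ∑ e, ∑ b, ∑ a, eta e b • (fnH (P.F e c * P.F a b) ▷ dx P a)

end QGeo

end

open QGeo
open Complex (I)

/-! The one-forms are a free bimodule on nine central elements, and every claim reduces to that
frame.

The coordinates come from inner derivations. Sending `da` to `[w, a]` and `θ'` to a scalar `t`
respects linearity, the Leibniz rule and the centrality of `θ'` for every `w` and `t`, so it extends
to a bimodule map `Ω¹ → A` as soon as the five commutation relations hold (`freeFunctional_rel`).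
They hold for `w = p_b` and `w = x^b` with `t = 0`, and for the Hamiltonian `h = η^{ab} p_a p_b /
2m` with `t = -iħ`. Rescaled, these maps are `coordY`, `coordZ` and `coordT`; write `T` for the
last, so `T(da) = (i/ħ)[h, a]` and `T(θ') = 1`. The dual frame is `y^a = dx^a - T(dx^a) θ'`, `z_c =
dp_c + q F_{ac} y^a - T(dp_c) θ'` and `θ'`. Its members are central and generate (`expand_form`).
The change from this frame to `dx^a, dp_c, θ'` is triangular, which gives the basis statement.

For a central frame `e_i`, the flip of the frame is a bimodule map, and any central `N_i` define a
bimodule connection `∇(a.e_i) = e_i ⊗ da + a.N_i` with that braiding (`CentralFrame.connection`).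
Here the only nonzero choice is `∇y^d = -(1/m) η^{dd} θ' ⊗ z_d`. Writing `ξ = ξ^i.e_i`, one has `σ(ξ
⊗ ζ) - ζ ⊗ ξ = -[ζ, ξ^i] ⊗ e_i`, so all correction terms in the braidings of `dx` and `dp` are
commutators known from the calculus.

On wave functions the operator in `∇_E` is `K = ∂_s + (i/ħ) h`, and `∂_s` commutes with the algebra.
Hence `[K, a] = T(da)`, which makes `σ_E(ξ ⊗ φ) = T(ξ)φ ⊗ ds` the braiding. The covariant derivative
of `σ_E` then has coefficient `[K, T(ξ)] - (T·T)(∇ξ)`. Since `T` kills `y^a` and `z_c`, only the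
term `θ' ⊗ dT(ξ)` of `∇ξ` contributes, with value `T(dT(ξ)) = [K, T(ξ)]`, and the two cancel
(`doubleNabla_eq_zero`). -/

open scoped TensorProduct ContDiff
open MulOpposite (op)

noncomputable section

namespace QGeo

open Complex (I)
open Background

/-! ### Arithmetic of bimodule actions and balanced tensors -/

section BimoduleArithmetic

variable {A B C : Type} [Ring A] [Algebra ℂ A] [Ring B] [Algebra ℂ B] [Ring C] [Algebra ℂ C]
variable {M N : Type} [AddCommGroup M] [Module ℂ M] [AddCommGroup N] [Module ℂ N]
variable [Bimodule A B M] [Bimodule B C N] {ι : Type*}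

theorem lact_zero (a : A) : a ▷ (0 : M) = 0 := by simp [lact]
theorem zero_lact (m : M) : (0 : A) ▷ m = 0 := by simp [lact]
theorem neg_lact (a : A) (m : M) : (-a) ▷ m = -(a ▷ m) := by simp [lact]
theorem lact_sub (a : A) (m m' : M) : a ▷ (m - m') = a ▷ m - a ▷ m' := by simp [lact]
theorem sub_lact (a a' : A) (m : M) : (a - a') ▷ m = a ▷ m - a' ▷ m := by simp [lact]
theorem lact_sum (a : A) (s : Finset ι) (m : ι → M) : a ▷ (∑ i ∈ s, m i) = ∑ i ∈ s, a ▷ m i := by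
  simp [lact]
theorem sum_lact (s : Finset ι) (a : ι → A) (m : M) : (∑ i ∈ s, a i) ▷ m = ∑ i ∈ s, a i ▷ m := by
  simp [lact]
theorem sub_ract (m m' : M) (b : B) : (m - m') ◁ b = m ◁ b - m' ◁ b := by simp [ract]
theorem zero_ract (b : B) : (0 : M) ◁ b = 0 := by simp [ract]
theorem sum_ract (s : Finset ι) (m : ι → M) (b : B) : (∑ i ∈ s, m i) ◁ b = ∑ i ∈ s, m i ◁ b := by
  simp [ract]
theorem tmul_zero (m : M) : m ⊠ (0 : N) = 0 := map_zero _
theorem zero_tmul (n : N) : (0 : M) ⊠ n = 0 := LinearMap.map_zero₂ _ _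
theorem tmul_neg (m : M) (n : N) : m ⊠ (-n) = -(m ⊠ n) := map_neg _ _
theorem neg_tmul (m : M) (n : N) : (-m) ⊠ n = -(m ⊠ n) := LinearMap.map_neg₂ _ _ _
theorem tmul_sub (m : M) (n n' : N) : m ⊠ (n - n') = m ⊠ n - m ⊠ n' := map_sub _ _ _
theorem sub_tmul (m m' : M) (n : N) : (m - m') ⊠ n = m ⊠ n - m' ⊠ n :=
  LinearMap.map_sub₂ _ _ _ _
theorem tmul_sum (s : Finset ι) (m : M) (n : ι → N) : m ⊠ (∑ i ∈ s, n i) = ∑ i ∈ s, m ⊠ n i :=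
  map_sum _ _ _
theorem sum_tmul (s : Finset ι) (m : ι → M) (n : N) : (∑ i ∈ s, m i) ⊠ n = ∑ i ∈ s, m i ⊠ n :=
  LinearMap.map_sum₂ _ _ _ _

/-- The element `m` commutes with the algebra. -/
def IsCentral {Ω : Type} [AddCommGroup Ω] [Module ℂ Ω] [Bimodule A A Ω] (m : Ω) : Prop :=
  ∀ a : A, m ◁ a = a ▷ m

end BimoduleArithmetic

/-! ## The Minkowski metric -/

theorem eta_of_ne {a b : Fin 4} (h : a ≠ b) : eta a b = 0 := if_neg h

section
variable {M : Type*} [AddCommMonoid M] [Module ℂ M]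

/-- The metric is diagonal, so each contraction collapses to one term. Formulas below carry `eta a
a` and a single index; the double sums of the theorem are matched with them only at the end. -/
theorem sum_eta_smul (a : Fin 4) (G : Fin 4 → M) : ∑ b, eta a b • G b = eta a a • G a := by
  rw [Finset.sum_eq_single a (fun b _ h => by rw [eta_of_ne h.symm, zero_smul]) (by simp)]

theorem sum_eta_smul' (a : Fin 4) (G : Fin 4 → M) : ∑ b, eta b a • G b = eta a a • G a := by
  rw [Finset.sum_eq_single a (fun b _ h => by rw [eta_of_ne h, zero_smul]) (by simp)]

end

/-! ## Relations of the Heisenberg algebra -/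

variable {P : Background}

theorem Background.m_ne' : P.mc ≠ 0 := by simp [Background.mc, P.m_ne]

theorem Background.F_antisymm (a b : Fin 4) : P.F a b = -P.F b a := by
  ext x
  change faraday P.pot a b x = -faraday P.pot b a x
  simp [faraday]

theorem Background.differentiable_fn (f : P.Fn) : Differentiable ℝ f.1 :=
  (P.fn_smooth f.1 f.2).differentiable (by simp)

theorem Background.pd_add (a : Fin 4) (f g : P.Fn) : P.pd a (f + g) = P.pd a f + P.pd a g := by
  ext x
  change fderiv ℝ (f.1 + g.1) x _ = fderiv ℝ f.1 x _ + fderiv ℝ g.1 x _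
  rw [fderiv_add (differentiable_fn f x) (differentiable_fn g x)]
  rfl

theorem Background.pd_smul (a : Fin 4) (c : ℂ) (f : P.Fn) : P.pd a (c • f) = c • P.pd a f := by
  ext x
  change fderiv ℝ (c • f.1) x _ = c • fderiv ℝ f.1 x _
  rw [fderiv_const_smul (differentiable_fn f x)]
  rfl

/-- `f ↦ f_{,a}` as a linear map -/
def Background.pdₗ (P : Background) (a : Fin 4) : P.Fn →ₗ[ℂ] P.Fn where
  toFun := P.pd a
  map_add' := pd_add a
  map_smul' := pd_smul a

theorem Background.pd_neg (a : Fin 4) (f : P.Fn) : P.pd a (-f) = -P.pd a f :=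
  map_neg (P.pdₗ a) f

/-- Symmetry of the second derivative of a smooth function, once `fderiv` of a directional
derivative is rewritten as the second `fderiv`. -/
theorem Background.pd_comm (a b : Fin 4) (f : P.Fn) : P.pd a (P.pd b f) = P.pd b (P.pd a f) := by
  have hf : ContDiff ℝ ∞ f.1 := P.fn_smooth f.1 f.2
  have h2 : ∀ (v w : Spacetime) (x : Spacetime), fderiv ℝ (fun y => fderiv ℝ f.1 y v) x w
      = fderiv ℝ (fderiv ℝ f.1) x w v := by
    intro v w x
    have hd : DifferentiableAt ℝ (fderiv ℝ f.1) x :=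
      ((hf.fderiv_right (m := ∞) (by simp)).differentiable (by simp)) x
    rw [fderiv_clm_apply hd (differentiableAt_const v)]
    simp
  ext x
  change fderiv ℝ (fun y => fderiv ℝ f.1 y _) x _ = fderiv ℝ (fun y => fderiv ℝ f.1 y _) x _
  rw [h2, h2]
  exact (hf.contDiffAt.isSymmSndFDerivAt (by
    rw [minSmoothness_of_isRCLikeNormedField]; exact ENat.LEInfty.out)) _ _

theorem Background.pd_coord (a b : Fin 4) : P.pd a (P.coord b) = if a = b then 1 else 0 := by
  ext x
  have h : HasFDerivAt (fun x : Spacetime => (x b : ℂ))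
      (Complex.ofRealCLM.comp (ContinuousLinearMap.proj (R := ℝ) (φ := fun _ : Fin 4 => ℝ) b)) x :=
    (Complex.ofRealCLM.comp
      (ContinuousLinearMap.proj (R := ℝ) (φ := fun _ : Fin 4 => ℝ) b)).hasFDerivAt
  change fderiv ℝ (fun x : Spacetime => (x b : ℂ)) x (Pi.single a 1) = _
  rw [h.fderiv]
  by_cases hab : a = b
  · subst hab
    simp
  · simp [hab]

theorem Background.F1_antisymm (a b c : Fin 4) : P.F1 a b c = -P.F1 b a c := by
  rw [F1, F_antisymm, pd_neg, F1]

theorem Background.F2_comm (a b c d : Fin 4) : P.F2 a b c d = P.F2 a b d c :=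
  pd_comm _ _ _

variable (P) in
/-- the inclusion of the functions of `x` into the Heisenberg algebra -/
def fnHom : P.Fn →ₐ[ℂ] Heis P where
  toFun := fnH
  map_one' := by
    have h := RingQuot.mkAlgHom_rel ℂ (HeisRel.fn_const (P := P) 1)
    rw [AlgHom.commutes, map_one, map_one] at h
    exact h
  map_mul' f g := by
    have h := RingQuot.mkAlgHom_rel ℂ (HeisRel.fn_mul (P := P) f g)
    rw [map_mul] at h
    exact h
  map_zero' := by
    have h := RingQuot.mkAlgHom_rel ℂ (HeisRel.fn_const (P := P) 0)
    rw [AlgHom.commutes, map_zero, map_zero] at h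
    exact h
  map_add' f g := by
    have h := RingQuot.mkAlgHom_rel ℂ (HeisRel.fn_add (P := P) f g)
    rw [map_add] at h
    exact h
  commutes' c := by
    have h := RingQuot.mkAlgHom_rel ℂ (HeisRel.fn_const (P := P) c)
    rw [AlgHom.commutes] at h
    exact h

theorem fnH_add (f g : P.Fn) : fnH (f + g) = fnH f + fnH g := map_add (fnHom P) f g
theorem fnH_neg (f : P.Fn) : fnH (-f) = -fnH f := map_neg (fnHom P) f
theorem fnH_sub (f g : P.Fn) : fnH (f - g) = fnH f - fnH g := map_sub (fnHom P) f g
theorem fnH_mul (f g : P.Fn) : fnH (f * g) = fnH f * fnH g := map_mul (fnHom P) f g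
theorem fnH_one : fnH (1 : P.Fn) = 1 := map_one (fnHom P)
theorem fnH_zero : fnH (0 : P.Fn) = 0 := map_zero (fnHom P)
theorem fnH_smul (c : ℂ) (f : P.Fn) : fnH (c • f) = c • fnH f := map_smul (fnHom P) c f
theorem fnH_sum {ι : Type*} (s : Finset ι) (f : ι → P.Fn) :
    fnH (∑ i ∈ s, f i) = ∑ i ∈ s, fnH (f i) := map_sum (fnHom P) f s

theorem fnH_comm (f g : P.Fn) : fnH f * fnH g = fnH g * fnH f := by
  rw [← fnH_mul, mul_comm, fnH_mul]

theorem fnH_mul_pH (f : P.Fn) (a : Fin 4) :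
    fnH f * pH P a = pH P a * fnH f + (I * P.ħ) • fnH (P.pd a f) := by
  have h := RingQuot.mkAlgHom_rel ℂ (HeisRel.fn_p (P := P) f a)
  rw [map_sub, map_mul, map_mul, map_smul] at h
  exact sub_eq_iff_eq_add'.1 h

theorem pH_mul_fnH (f : P.Fn) (a : Fin 4) :
    pH P a * fnH f = fnH f * pH P a - (I * P.ħ) • fnH (P.pd a f) := by
  rw [fnH_mul_pH, add_sub_cancel_right]

theorem pH_mul_pH (a b : Fin 4) :
    pH P a * pH P b = pH P b * pH P a + (I * P.ħ * P.qc) • fnH (P.F a b) := by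
  have h := RingQuot.mkAlgHom_rel ℂ (HeisRel.p_p (P := P) a b)
  rw [map_sub, map_mul, map_mul, map_smul] at h
  exact sub_eq_iff_eq_add'.1 h

theorem Heis.induction {p : Heis P → Prop} (h_const : ∀ c : ℂ, p (algebraMap ℂ _ c))
    (h_fn : ∀ f, p (fnH f)) (h_p : ∀ a, p (pH P a)) (h_add : ∀ a b, p a → p b → p (a + b))
    (h_mul : ∀ a b, p a → p b → p (a * b)) (a : Heis P) : p a := by
  obtain ⟨u, rfl⟩ := RingQuot.mkAlgHom_surjective ℂ (HeisRel P) a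
  induction u using FreeAlgebra.induction with
  | grade0 r => rw [AlgHom.commutes]; exact h_const r
  | grade1 x => rcases x with f | c; exacts [h_fn f, h_p c]
  | mul u v hu hv => rw [map_mul]; exact h_mul _ _ hu hv
  | add u v hu hv => rw [map_add]; exact h_add _ _ hu hv

/-! ## One-forms -/

theorem toΩ_lact (a : Heis P) (ξ : FreeForm P) : toΩ P (freeL a ξ) = a ▷ toΩ P ξ := rfl
theorem toΩ_ract (a : Heis P) (ξ : FreeForm P) : toΩ P (freeR ξ a) = toΩ P ξ ◁ a := rfl
theorem toΩ_add (ξ ζ : FreeForm P) : toΩ P (ξ + ζ) = toΩ P ξ + toΩ P ζ := rfl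
theorem toΩ_sub (ξ ζ : FreeForm P) : toΩ P (ξ - ζ) = toΩ P ξ - toΩ P ζ := rfl
theorem toΩ_smul (c : ℂ) (ξ : FreeForm P) : toΩ P (c • ξ) = c • toΩ P ξ := rfl
theorem toΩ_sum {ι : Type*} (s : Finset ι) (ξ : ι → FreeForm P) :
    toΩ P (∑ i ∈ s, ξ i) = ∑ i ∈ s, toΩ P (ξ i) := map_sum (formRelations P).mkQ _ _

theorem toΩ_freeComm (a : Heis P) (ξ : FreeForm P) :
    toΩ P (freeComm ξ a) = toΩ P ξ ◁ a - a ▷ toΩ P ξ := rfl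

theorem Env.induction {p : Env P → Prop} (h_zero : p 0)
    (h_mul : ∀ (a : Heis P) (b : (Heis P)ᵐᵒᵖ), p (envL P a * envR P b))
    (h_add : ∀ x y, p x → p y → p (x + y)) (e : Env P) : p e := by
  refine TensorProduct.induction_on (motive := p) e h_zero (fun a b => ?_) h_add
  have h := h_mul a b
  have h' : envL P a * envR P b = (a ⊗ₜ[ℂ] b : Heis P ⊗[ℂ] (Heis P)ᵐᵒᵖ) := by
    change (a ⊗ₜ[ℂ] (1 : (Heis P)ᵐᵒᵖ)) * ((1 : Heis P) ⊗ₜ[ℂ] b) = _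
    rw [Algebra.TensorProduct.tmul_mul_tmul, mul_one, one_mul]
  rwa [h'] at h

/-- Ω¹ is a quotient of the free bimodule on the symbols `da` and `θ'`, so a property stable under
sums and both actions need only be checked on those. -/
theorem Form.induction {p : Form P → Prop} (h_zero : p 0) (h_add : ∀ ξ ζ, p ξ → p ζ → p (ξ + ζ))
    (h_lact : ∀ (a : Heis P) ξ, p ξ → p (a ▷ ξ)) (h_ract : ∀ (a : Heis P) ξ, p ξ → p (ξ ◁ a))
    (h_d : ∀ a, p ((heisCalculus P).d a)) (h_θ : p (θ P)) (ξ : Form P) : p ξ := by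
  obtain ⟨u, rfl⟩ := (formRelations P).mkQ_surjective ξ
  change p (toΩ P u)
  induction u using Finsupp.induction_linear with
  | zero => exact h_zero
  | add u v hu hv => rw [toΩ_add]; exact h_add _ _ hu hv
  | single g e =>
    have hg : p (toΩ P (Finsupp.single g 1)) := by
      rcases g with a | _
      exacts [h_d a, h_θ]
    induction e using Env.induction with
    | h_zero => rw [Finsupp.single_zero]; exact h_zero
    | h_add x y hx hy => rw [Finsupp.single_add, toΩ_add]; exact h_add _ _ hx hy
    | h_mul a b =>
      have h : (Finsupp.single g (envL P a * envR P b) : FreeForm P)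
          = freeL a (freeR (Finsupp.single g 1) b.unop) := by
        rw [freeL, freeR, Finsupp.smul_single, Finsupp.smul_single, smul_eq_mul, smul_eq_mul,
          mul_one, MulOpposite.op_unop]
      rw [h, toΩ_lact, toΩ_ract]
      exact h_lact _ _ (h_ract _ _ hg)

theorem isCentral_theta : IsCentral (θ P) := fun a => by
  have h := toΩ_eq P (ζ := 0) (by rw [sub_zero]; exact FormRel.theta_central a)
  rw [toΩ_freeComm] at h
  exact sub_eq_zero.1 h

theorem d_fnH (f : P.Fn) : (heisCalculus P).d (fnH f)
    = ∑ a, fnH (P.pd a f) ▷ dx P a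
      - (I * P.ħ / (2 * P.mc)) • ∑ a, eta a a • fnH (P.pd a (P.pd a f)) ▷ θ P := by
  have h := toΩ_eq P (FormRel.d_fn f)
  simp only [toΩ_sub, toΩ_sum, toΩ_smul, toΩ_lact, sum_eta_smul] at h
  exact h

theorem dx_ract_fnH (a : Fin 4) (f : P.Fn) : dx P a ◁ fnH f
    = fnH f ▷ dx P a - (I * P.ħ / P.mc * eta a a) • fnH (P.pd a f) ▷ θ P := by
  have h := toΩ_eq P (FormRel.dx_fn a f)
  simp only [toΩ_freeComm, toΩ_smul, toΩ_lact, sum_eta_smul] at h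
  rw [mul_smul, sub_eq_add_neg, ← neg_smul]
  exact sub_eq_iff_eq_add'.1 h

theorem dx_ract_pH (a c : Fin 4) : dx P a ◁ pH P c
    = pH P c ▷ dx P a + (I * P.ħ * P.qc / P.mc * eta a a) • fnH (P.F a c) ▷ θ P := by
  have h := toΩ_eq P (FormRel.dx_p a c)
  simp only [toΩ_freeComm, toΩ_smul, toΩ_lact, sum_eta_smul] at h
  rw [mul_smul]
  exact sub_eq_iff_eq_add'.1 h

theorem dp_ract_fnH (c : Fin 4) (f : P.Fn) : dp P c ◁ fnH f
    = fnH f ▷ dp P c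
      + (I * P.ħ * P.qc / P.mc) • ∑ a, eta a a • fnH (P.F a c * P.pd a f) ▷ θ P := by
  have h := toΩ_eq P (FormRel.dp_fn c f)
  simp only [toΩ_freeComm, toΩ_sum, toΩ_smul, toΩ_lact, sum_eta_smul] at h
  exact sub_eq_iff_eq_add'.1 h

theorem dp_ract_pH (c d : Fin 4) : dp P c ◁ pH P d
    = pH P d ▷ dp P c - (I * P.ħ * P.qc) • ∑ a, fnH (P.F1 a c d) ▷ dx P a
      + (I * P.ħ * P.qc / (2 * P.mc)) • ∑ a, eta a a •
          ((I * P.ħ) • fnH (P.F2 a c a d) ▷ θ P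
            - (2 * P.qc) • (fnH (P.F a c) * fnH (P.F a d)) ▷ θ P) := by
  have h := toΩ_eq P (FormRel.dp_p c d)
  simp only [toΩ_freeComm, toΩ_sum, toΩ_sub, toΩ_smul, toΩ_lact, sum_eta_smul] at h
  have h' := sub_eq_iff_eq_add'.1 h
  refine h'.trans ?_
  rw [← add_sub_assoc, neg_smul, ← sub_eq_add_neg, sub_eq_add_neg _ (_ • ∑ _, _)]
  congr 1
  simp only [Finset.smul_sum, ← Finset.sum_neg_distrib]
  refine Finset.sum_congr rfl fun a _ => ?_
  simp only [fnH_add, fnH_smul, fnH_mul, add_lact, smul_lact,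
    show toΩ P (symTheta P) = θ P from rfl]
  match_scalars
  · linear_combination (-(P.ħ ^ 2 * P.qc / (2 * P.mc) * eta a a)) * Complex.I_sq
  · ring

/-! ## Bimodule maps from one-forms to the algebra -/

/-- With the algebra viewed as a module over its enveloping algebra, a bimodule map `Ω¹ → A` is an
`Env P`-linear map, determined on the free module by its values on symbols. -/
instance : Module (Env P) (Heis P) :=
  Module.compHom (Heis P) (AlgHom.mulLeftRight ℂ (Heis P)).toRingHom

theorem env_smul_def (e : Env P) (b : Heis P) : e • b = AlgHom.mulLeftRight ℂ (Heis P) e b := rfl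

theorem envL_smul (a b : Heis P) : envL P a • b = a * b := by
  refine (AlgHom.mulLeftRight_apply ℂ (Heis P) a 1 b).trans ?_
  simp

theorem envR_smul (a b : Heis P) : envR P (op a) • b = b * a := by
  refine (AlgHom.mulLeftRight_apply ℂ (Heis P) 1 (op a) b).trans ?_
  simp

instance : IsScalarTower ℂ (Env P) (Heis P) where
  smul_assoc c e b := by
    rw [env_smul_def, env_smul_def]
    exact LinearMap.congr_fun (map_smul (AlgHom.mulLeftRight ℂ (Heis P)) c e) b

/-- `w` generates an inner derivation of the Heisenberg algebra that, together with the value `t`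
for `θ'`, is compatible with the relations of the calculus. -/
structure InnerCompatible (w : Heis P) (t : ℂ) : Prop where
  d_fn : ∀ f : P.Fn, w * fnH f - fnH f * w
    = ∑ a, fnH (P.pd a f) * (w * xH P a - xH P a * w)
      - (I * P.ħ / (2 * P.mc) * t) • ∑ a, eta a a • fnH (P.pd a (P.pd a f))
  dx_fn : ∀ (a : Fin 4) (f : P.Fn), (w * xH P a - xH P a * w) * fnH f
      - fnH f * (w * xH P a - xH P a * w)
    = -(I * P.ħ / P.mc * t * eta a a) • fnH (P.pd a f)
  dx_p : ∀ a c : Fin 4, (w * xH P a - xH P a * w) * pH P c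
      - pH P c * (w * xH P a - xH P a * w)
    = (I * P.ħ * P.qc / P.mc * t * eta a a) • fnH (P.F a c)
  dp_fn : ∀ (c : Fin 4) (f : P.Fn), (w * pH P c - pH P c * w) * fnH f
      - fnH f * (w * pH P c - pH P c * w)
    = (I * P.ħ * P.qc / P.mc * t) • ∑ a, eta a a • (fnH (P.F a c) * fnH (P.pd a f))
  dp_p : ∀ c d : Fin 4, (w * pH P c - pH P c * w) * pH P d
      - pH P d * (w * pH P c - pH P c * w)
    = (-(I * P.ħ * P.qc)) • (∑ a, fnH (P.F1 a c d) * (w * xH P a - xH P a * w))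
      - (P.ħ * P.qc / (2 * P.mc) * t) • ∑ a, eta a a •
          (P.ħ • fnH (P.F2 a c a d) + (2 * I * P.qc) • (fnH (P.F a c) * fnH (P.F a d)))

/-- the values of a functional on the generating symbols -/
def genValue (w : Heis P) (t : ℂ) : FormGen P → Heis P
  | .d a => w * a - a * w
  | .theta => t • 1

/-- the functional on the free bimodule with given values on the generators -/
def freeFunctional (w : Heis P) (t : ℂ) : FreeForm P →ₗ[Env P] Heis P :=
  Finsupp.linearCombination (Env P) (genValue w t)

theorem freeFunctional_symD (w : Heis P) (t : ℂ) (a : Heis P) :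
    freeFunctional w t (symD a) = w * a - a * w := by
  simp [freeFunctional, symD, genValue]

theorem freeFunctional_symTheta (w : Heis P) (t : ℂ) :
    freeFunctional w t (symTheta P) = t • 1 := by
  simp [freeFunctional, symTheta, genValue]

theorem freeFunctional_freeL (w : Heis P) (t : ℂ) (a : Heis P) (ξ : FreeForm P) :
    freeFunctional w t (freeL a ξ) = a * freeFunctional w t ξ := by
  rw [freeL, map_smul, envL_smul]

theorem freeFunctional_freeR (w : Heis P) (t : ℂ) (a : Heis P) (ξ : FreeForm P) :
    freeFunctional w t (freeR ξ a) = freeFunctional w t ξ * a := by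
  rw [freeR, map_smul, envR_smul]

theorem freeFunctional_smul (w : Heis P) (t : ℂ) (c : ℂ) (ξ : FreeForm P) :
    freeFunctional w t (c • ξ) = c • freeFunctional w t ξ :=
  LinearMap.map_smul_of_tower _ c ξ

/-- A commutator is automatically a derivation and a scalar is automatically central, so the first
four relations hold for every `w` and `t`. The other five are the fields of `InnerCompatible`. -/
theorem freeFunctional_rel {w : Heis P} {t : ℂ} (h : InnerCompatible w t) {ξ : FreeForm P}
    (hξ : FormRel P ξ) : freeFunctional w t ξ = 0 := by
  induction hξ with
  | d_add a b =>
    simp only [map_sub, map_add, freeFunctional_symD]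
    noncomm_ring
  | d_smul c a =>
    simp only [map_sub, freeFunctional_smul, freeFunctional_symD, mul_smul_comm, smul_mul_assoc,
      smul_sub, sub_self]
  | leibniz a b =>
    simp only [map_sub, map_add, freeFunctional_symD, freeFunctional_freeL, freeFunctional_freeR]
    noncomm_ring
  | theta_central a =>
    simp only [freeComm, map_sub, freeFunctional_freeL, freeFunctional_freeR,
      freeFunctional_symTheta, mul_smul_comm, smul_mul_assoc, mul_one, one_mul, sub_self]
  | d_fn f =>
    simp only [map_sub, map_sum, freeFunctional_smul, freeFunctional_symD, freeFunctional_freeL,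
      freeFunctional_symTheta, sum_eta_smul, h.d_fn, mul_smul_comm, mul_one, Finset.smul_sum,
      smul_smul]
    rw [sub_eq_zero]
    congr 1
    refine Finset.sum_congr rfl fun a _ => ?_
    congr 1
    ring
  | dx_fn a f =>
    simp only [freeComm, map_sub, freeFunctional_smul, freeFunctional_symD,
      freeFunctional_freeL, freeFunctional_freeR,
      freeFunctional_symTheta, sum_eta_smul, h.dx_fn, mul_smul_comm, mul_one]
    module
  | dx_p a c =>
    simp only [freeComm, map_sub, freeFunctional_smul, freeFunctional_symD,
      freeFunctional_freeL, freeFunctional_freeR,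
      freeFunctional_symTheta, sum_eta_smul, h.dx_p, mul_smul_comm, mul_one]
    module
  | dp_fn c f =>
    simp only [freeComm, map_sub, map_sum, freeFunctional_smul, freeFunctional_symD,
      freeFunctional_freeL, freeFunctional_freeR,
      freeFunctional_symTheta, sum_eta_smul, h.dp_fn, mul_smul_comm, mul_one, fnH_mul,
      Finset.smul_sum, smul_smul]
    rw [sub_eq_zero]
    refine Finset.sum_congr rfl fun a _ => ?_
    congr 1
    ring
  | dp_p c d =>
    simp only [freeComm, map_sub, map_sum, freeFunctional_smul, freeFunctional_symD,
      freeFunctional_freeL, freeFunctional_freeR,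
      freeFunctional_symTheta, sum_eta_smul, h.dp_p, mul_smul_comm, mul_one, fnH_mul, fnH_add,
      fnH_smul, Finset.smul_sum]
    rw [sub_eq_zero]
    congr 1
    refine Finset.sum_congr rfl fun a _ => ?_
    module

/-- the bimodule map `Ω¹ → A` with `da ↦ [w, a]` and `θ' ↦ t` -/
def functional {w : Heis P} {t : ℂ} (h : InnerCompatible w t) : Form P →ₗ[ℂ] Heis P :=
  ((formRelations P).liftQ (freeFunctional w t)
    (Submodule.span_le.2 fun _ hξ => freeFunctional_rel h hξ)).restrictScalars ℂ

section
variable {w : Heis P} {t : ℂ} (h : InnerCompatible w t)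

theorem functional_d (a : Heis P) : functional h ((heisCalculus P).d a) = w * a - a * w :=
  freeFunctional_symD w t a

theorem functional_theta : functional h (θ P) = t • 1 := freeFunctional_symTheta w t

theorem functional_lact (a : Heis P) (ξ : Form P) :
    functional h (a ▷ ξ) = a * functional h ξ := by
  obtain ⟨u, rfl⟩ := (formRelations P).mkQ_surjective ξ
  exact freeFunctional_freeL w t a u

theorem functional_ract (a : Heis P) (ξ : Form P) :
    functional h (ξ ◁ a) = functional h ξ * a := by
  obtain ⟨u, rfl⟩ := (formRelations P).mkQ_surjective ξ
  exact freeFunctional_freeR w t a u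

end

/-! ## The three families of inner derivations -/

theorem fnH_mul_fnH_sub (f g : P.Fn) : fnH f * fnH g - fnH g * fnH f = 0 := by
  rw [fnH_comm, sub_self]

theorem pH_comm_fnH (f : P.Fn) (a : Fin 4) :
    pH P a * fnH f - fnH f * pH P a = (-(I * P.ħ)) • fnH (P.pd a f) := by
  rw [fnH_mul_pH]; module

theorem fnH_comm_pH (f : P.Fn) (a : Fin 4) :
    fnH f * pH P a - pH P a * fnH f = (I * P.ħ) • fnH (P.pd a f) := by
  rw [fnH_mul_pH]; module

theorem pH_comm_pH (a b : Fin 4) :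
    pH P a * pH P b - pH P b * pH P a = (I * P.ħ * P.qc) • fnH (P.F a b) := by
  rw [pH_mul_pH]; module

theorem fnH_pd_coord (a b : Fin 4) :
    fnH (P.pd a (P.coord b)) = if a = b then 1 else 0 := by
  rw [pd_coord]
  split_ifs
  exacts [fnH_one, fnH_zero]

theorem I_div_ħ_mul : I / P.ħ * (I * P.ħ) = -1 := by
  have := StateSpace.ħ_ne (P := P)
  field_simp
  exact Complex.I_sq

/-- Every relation is jointly linear in the commutators with `w` and in `t`. This allows the
normalisation by `i/ħ` that makes the coordinates dual to the frame. -/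
theorem innerCompatible_smul {w : Heis P} {t s : ℂ} (h : InnerCompatible w t) :
    InnerCompatible (s • w) (s * t) where
  d_fn f := by
    simp only [smul_mul_assoc, mul_smul_comm, ← smul_sub, h.d_fn, ← Finset.smul_sum]
    module
  dx_fn a f := by
    simp only [smul_mul_assoc, mul_smul_comm, ← smul_sub, h.dx_fn]
    module
  dx_p a f := by
    simp only [smul_mul_assoc, mul_smul_comm, ← smul_sub, h.dx_p]
    module
  dp_fn a f := by
    simp only [smul_mul_assoc, mul_smul_comm, ← smul_sub, h.dp_fn]
    module
  dp_p a f := by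
    simp only [smul_mul_assoc, mul_smul_comm, ← smul_sub, h.dp_p, ← Finset.smul_sum]
    module

/-- Commutation with `p_b` is `-iħ ∂_b` on functions: a first-order derivation, so no `θ'`
contribution is needed. As `[p_b, x^a]` is a scalar and `[p_b, p_c]` a function, the only nontrivial
check is `[[p_b, p_c], p_d]`, which produces `F_{bc,d}`. -/
theorem innerCompatible_pH (b : Fin 4) : InnerCompatible (pH P b) 0 where
  d_fn f := by
    simp [xH, pH_comm_fnH, fnH_pd_coord]
  dx_fn a f := by
    simp only [xH, pH_comm_fnH, fnH_pd_coord]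
    split_ifs <;> simp
  dx_p a c := by
    simp only [xH, pH_comm_fnH, fnH_pd_coord]
    split_ifs <;> simp
  dp_fn c f := by
    simp only [pH_comm_pH, smul_mul_assoc, mul_smul_comm, ← smul_sub, fnH_mul_fnH_sub]
    simp
  dp_p c d := by
    simp only [pH_comm_pH, xH, pH_comm_fnH, fnH_pd_coord, smul_mul_assoc, mul_smul_comm,
      ← smul_sub, fnH_comm_pH]
    simp [smul_smul, F1]

/-- Commutation with `x^b` kills functions and sends each `p_c` to a scalar, so all second
commutators vanish. -/
theorem innerCompatible_xH (b : Fin 4) : InnerCompatible (xH P b) 0 where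
  d_fn f := by
    simp [xH, fnH_mul_fnH_sub]
  dx_fn a f := by
    simp [xH, fnH_mul_fnH_sub]
  dx_p a c := by
    simp [xH, fnH_mul_fnH_sub]
  dp_fn c f := by
    simp only [xH, fnH_comm_pH, fnH_pd_coord]
    split_ifs <;> simp
  dp_p c d := by
    simp only [xH, fnH_comm_pH, fnH_pd_coord, fnH_mul_fnH_sub]
    split_ifs <;> simp

variable (P) in
/-- the Hamiltonian `η^{ab} p_a p_b / 2m` -/
def hamiltonian : Heis P := (1 / (2 * P.mc)) • ∑ a, eta a a • (pH P a * pH P a)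

theorem hamiltonian_comm_fnH (f : P.Fn) : hamiltonian P * fnH f - fnH f * hamiltonian P
    = (1 / (2 * P.mc)) • ∑ a, eta a a • ((-(2 * (I * P.ħ))) • (fnH (P.pd a f) * pH P a)
        - P.ħ ^ 2 • fnH (P.pd a (P.pd a f))) := by
  have hI : I * I = -1 := Complex.I_mul_I
  simp only [hamiltonian, smul_mul_assoc, mul_smul_comm, ← smul_sub, Finset.sum_mul,
    Finset.mul_sum, ← Finset.sum_sub_distrib]
  congr 1
  refine Finset.sum_congr rfl fun a _ => ?_
  congr 1
  rw [mul_assoc, pH_mul_fnH, mul_sub, ← mul_assoc, mul_smul_comm, pH_mul_fnH, pH_mul_fnH, sub_mul,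
    smul_mul_assoc, mul_assoc]
  match_scalars <;> first | ring1 | linear_combination P.ħ ^ 2 * hI

/-- Coordinates have zero second derivatives, so only the term linear in `p` survives in the
commutator with the quadratic Hamiltonian. -/
theorem hamiltonian_comm_xH (a : Fin 4) : hamiltonian P * xH P a - xH P a * hamiltonian P
    = (-(I * P.ħ / P.mc) * eta a a) • pH P a := by
  have hm := P.m_ne'
  rw [xH, hamiltonian_comm_fnH]
  have h0 : ∀ b, P.pd b (P.pd b (P.coord a)) = 0 := by
    intro b
    rw [pd_coord]
    split_ifs
    · ext x
      exact congrFun (congrArg DFunLike.coe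
        (fderiv_const_apply (𝕜 := ℝ) (E := Spacetime) (x := x) (1 : ℂ))) _
    · exact map_zero (P.pdₗ b)
  simp only [h0, fnH_zero, fnH_pd_coord, smul_zero, sub_zero, ite_mul, one_mul, zero_mul]
  rw [Finset.sum_eq_single a (fun b _ h => by rw [if_neg h, smul_zero, smul_zero]) (by simp),
    if_pos rfl]
  match_scalars
  field_simp

theorem hamiltonian_comm_pH (c : Fin 4) : hamiltonian P * pH P c - pH P c * hamiltonian P
    = (I * P.ħ * P.qc / (2 * P.mc)) • ∑ a, eta a a •
      ((2 : ℂ) • (fnH (P.F a c) * pH P a) - (I * P.ħ) • fnH (P.F1 a c a)) := by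
  simp only [hamiltonian, smul_mul_assoc, mul_smul_comm, ← smul_sub, Finset.sum_mul,
    Finset.mul_sum, ← Finset.sum_sub_distrib, Finset.smul_sum]
  refine Finset.sum_congr rfl fun a _ => ?_
  -- The derivation property gives `[p_a p_a, p_c] = p_a [p_a, p_c] + [p_a, p_c] p_a`; the ordering
  -- of `p_a` past `F_{ac}` then creates the derivative term.
  have h : pH P a * pH P a * pH P c - pH P c * (pH P a * pH P a)
      = (I * P.ħ * P.qc) • (pH P a * fnH (P.F a c) + fnH (P.F a c) * pH P a) := by
    rw [smul_add, ← mul_smul_comm, ← smul_mul_assoc, ← pH_comm_pH]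
    noncomm_ring
  rw [h, pH_mul_fnH, F1]
  module

/-- This is the family that detects `θ'`. The commutator `[h, f]` contains `-(ħ²/2m) η^{ab}
f_{,ab}`, and matching it with the second-order term of `df` forces `t = -iħ`. -/
theorem innerCompatible_hamiltonian : InnerCompatible (hamiltonian P) (-(I * P.ħ)) where
  d_fn f := by
    have hm := P.m_ne'
    simp only [hamiltonian_comm_fnH, hamiltonian_comm_xH, Finset.smul_sum, mul_smul_comm,
      ← Finset.sum_sub_distrib]
    refine Finset.sum_congr rfl fun a _ => ?_
    match_scalars
    · field_simp
    · linear_combination (-(P.ħ ^ 2 / (2 * P.mc) * eta a a)) * Complex.I_sq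
  dx_fn a f := by
    rw [hamiltonian_comm_xH, smul_mul_assoc, mul_smul_comm, ← smul_sub, pH_comm_fnH]
    module
  dx_p a c := by
    rw [hamiltonian_comm_xH, smul_mul_assoc, mul_smul_comm, ← smul_sub, pH_comm_pH]
    module
  dp_fn c f := by
    rw [hamiltonian_comm_pH]
    simp only [smul_mul_assoc, mul_smul_comm, Finset.sum_mul, Finset.mul_sum, ← smul_sub,
      ← Finset.sum_sub_distrib, Finset.smul_sum]
    refine Finset.sum_congr rfl fun a _ => ?_
    -- Only the factor `p_a` fails to commute with `f`.
    have h : ((2 : ℂ) • (fnH (P.F a c) * pH P a) - (I * P.ħ) • fnH (P.F1 a c a)) * fnH f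
        - fnH f * ((2 : ℂ) • (fnH (P.F a c) * pH P a) - (I * P.ħ) • fnH (P.F1 a c a))
        = (-(2 * (I * P.ħ))) • (fnH (P.F a c) * fnH (P.pd a f)) := by
      rw [sub_mul, mul_sub, smul_mul_assoc, mul_smul_comm, smul_mul_assoc, mul_smul_comm,
        fnH_comm f (P.F1 a c a), mul_assoc, pH_mul_fnH, mul_sub, ← mul_assoc, ← mul_assoc,
        fnH_comm f, mul_smul_comm]
      module
    rw [h]
    match_scalars
    ring
  dp_p c d := by
    have hm := P.m_ne'
    rw [hamiltonian_comm_pH]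
    simp only [smul_mul_assoc, mul_smul_comm, Finset.sum_mul, Finset.mul_sum, ← smul_sub,
      ← Finset.sum_sub_distrib, Finset.smul_sum, hamiltonian_comm_xH]
    refine Finset.sum_congr rfl fun a _ => ?_
    have h : ((2 : ℂ) • (fnH (P.F a c) * pH P a) - (I * P.ħ) • fnH (P.F1 a c a)) * pH P d
        - pH P d * ((2 : ℂ) • (fnH (P.F a c) * pH P a) - (I * P.ħ) • fnH (P.F1 a c a))
        = (2 : ℂ) • ((I * P.ħ) • (fnH (P.F1 a c d) * pH P a)
            + (I * P.ħ * P.qc) • (fnH (P.F a c) * fnH (P.F a d)))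
          - (I * P.ħ) • (I * P.ħ) • fnH (P.F2 a c a d) := by
      -- Derivatives and field strengths are turned back into commutators with `p_d` and `p_a`, so
      -- that what remains is an identity between noncommutative polynomials.
      rw [F2, ← fnH_comm_pH (P.F1 a c a), ← smul_mul_assoc (I * P.ħ) (fnH (P.F1 a c d)),
        show P.F1 a c d = P.pd d (P.F a c) from rfl, ← fnH_comm_pH,
        ← mul_smul_comm (I * P.ħ * P.qc), ← pH_comm_pH]
      simp only [sub_mul, mul_sub, smul_mul_assoc, mul_smul_comm, smul_sub, smul_add, mul_assoc]
      module
    rw [h]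
    match_scalars
    · field_simp
    · ring
    · linear_combination (-(P.ħ ^ 3 * P.qc * I / (2 * P.mc) * eta a a)) * Complex.I_sq

/-! ## The flip connection of a central frame -/

section Frame

variable {A Ω : Type} [Ring A] [Algebra ℂ A] [AddCommGroup Ω] [Module ℂ Ω] [Bimodule A A Ω]

/-- A finite frame of central elements of an `A`-bimodule, with coordinates that are bimodule
maps to `A`. -/
structure CentralFrame (ι A Ω : Type) [Fintype ι] [Ring A] [Algebra ℂ A] [AddCommGroup Ω]
    [Module ℂ Ω] [Bimodule A A Ω] where
  vec : ι → Ω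
  coord : ι → Ω →ₗ[ℂ] A
  central : ∀ i, IsCentral (vec i)
  coord_lact : ∀ i (a : A) ξ, coord i (a ▷ ξ) = a * coord i ξ
  coord_ract : ∀ i (a : A) ξ, coord i (ξ ◁ a) = coord i ξ * a
  expand : ∀ ξ, ∑ i, coord i ξ ▷ vec i = ξ

namespace CentralFrame

variable {ι : Type} [Fintype ι] (e : CentralFrame ι A Ω)

/-- A coefficient in the second factor passes through the balanced tensor and then through the
central vector. -/
theorem vec_tmul_lact (i : ι) (a : A) (ξ : Ω) : e.vec i ⊠ (a ▷ ξ) = a ▷ (e.vec i ⊠ ξ) := by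
  rw [← tmul_balanced, e.central, lact_tmul]

/-- `ξ ⊗ ζ ↦ Σ_i e_i ⊗ ξ.ζ^i` -/
def flip : BTensor Ω Ω →ₗ[ℂ] BTensor Ω Ω :=
  BTensor.lift
    (LinearMap.mk₂ ℂ (fun ξ ζ => ∑ i, e.vec i ⊠ (ξ ◁ e.coord i ζ))
      (fun ξ ξ' ζ => by simp only [add_ract, tmul_add, Finset.sum_add_distrib])
      (fun c ξ ζ => by simp only [smul_ract, tmul_smul, Finset.smul_sum])
      (fun ξ ζ ζ' => by simp only [map_add, ract_add, tmul_add, Finset.sum_add_distrib])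
      (fun c ξ ζ => by simp only [map_smul, ract_smul, tmul_smul, Finset.smul_sum]))
    (fun ξ a ζ => by simp only [LinearMap.mk₂_apply, e.coord_lact, ract_mul])

theorem flip_tmul (ξ ζ : Ω) : e.flip (ξ ⊠ ζ) = ∑ i, e.vec i ⊠ (ξ ◁ e.coord i ζ) :=
  BTensor.lift_tmul _ _ _ _

theorem flip_lact (a : A) (z : BTensor Ω Ω) : e.flip (a ▷ z) = a ▷ e.flip z := by
  have : e.flip.comp (Bimodule.left (B := A) a) = (Bimodule.left (B := A) a).comp e.flip := by
    refine BTensor.hom_ext fun ξ ζ => ?_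
    change e.flip (a ▷ (ξ ⊠ ζ)) = a ▷ e.flip (ξ ⊠ ζ)
    simp only [lact_tmul, flip_tmul, lact_sum, ← lact_ract, vec_tmul_lact]
  exact LinearMap.congr_fun this z

theorem flip_ract (z : BTensor Ω Ω) (a : A) : e.flip (z ◁ a) = e.flip z ◁ a := by
  have : e.flip.comp (Bimodule.right (A := A) (op a))
      = (Bimodule.right (A := A) (op a)).comp e.flip := by
    refine BTensor.hom_ext fun ξ ζ => ?_
    change e.flip ((ξ ⊠ ζ) ◁ a) = e.flip (ξ ⊠ ζ) ◁ a
    simp only [tmul_ract, flip_tmul, sum_ract, e.coord_ract, ract_mul]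
  exact LinearMap.congr_fun this z

/-- A central `ξ` lets each coordinate of `ζ` cross over to its own frame vector, and the expansion
of `ζ` reassembles. -/
theorem flip_central_left {ξ : Ω} (h : IsCentral ξ) (ζ : Ω) : e.flip (ξ ⊠ ζ) = ζ ⊠ ξ := by
  simp only [flip_tmul, h _, ← tmul_balanced, e.central _ _]
  rw [← sum_tmul, e.expand]

/-- A central scalar acts equally from both sides because this is visible on each term of the
expansion in central vectors. -/
theorem ract_eq_lact (e : CentralFrame ι A Ω) {z : A} (h : ∀ a, z * a = a * z) (ξ : Ω) :
    ξ ◁ z = z ▷ ξ := by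
  conv_lhs => rw [← e.expand ξ]
  conv_rhs => rw [← e.expand ξ]
  simp only [sum_ract, lact_sum, ← lact_ract, e.central _ _, ← mul_lact, h]

/-- The coordinates are bimodule maps, so those of a central `ζ` are central in the algebra and may
be moved to the other side of `ξ`. -/
theorem flip_central_right (ξ : Ω) {ζ : Ω} (h : IsCentral ζ) : e.flip (ξ ⊠ ζ) = ζ ⊠ ξ := by
  have hz : ∀ i a, e.coord i ζ * a = a * e.coord i ζ := fun i a => by
    rw [← e.coord_ract, h, e.coord_lact]
  simp only [flip_tmul, e.ract_eq_lact (hz _), ← tmul_balanced]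
  rw [← sum_tmul, e.expand]

/-- `∇ ξ = Σ_i e_i ⊗ dξ^i + ξ^i.N_i` -/
def nabla (dA : Calculus A Ω) (N : ι → BTensor Ω Ω) : Ω →ₗ[ℂ] BTensor Ω Ω where
  toFun ξ := ∑ i, (e.vec i ⊠ dA.d (e.coord i ξ) + e.coord i ξ ▷ N i)
  map_add' ξ ζ := by
    simp only [map_add, tmul_add, add_lact, Finset.sum_add_distrib]
    abel
  map_smul' c ξ := by
    simp only [map_smul, tmul_smul, smul_lact, Finset.smul_sum, smul_add, RingHom.id_apply]

theorem nabla_apply (dA : Calculus A Ω) (N : ι → BTensor Ω Ω) (ξ : Ω) :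
    e.nabla dA N ξ = ∑ i, (e.vec i ⊠ dA.d (e.coord i ξ) + e.coord i ξ ▷ N i) := rfl

/-- The connection `∇(a.e_i) = e_i ⊗ da + a.N_i` with central `N_i`, whose braiding is the flip
of the frame. -/
def connection (dA : Calculus A Ω) (N : ι → BTensor Ω Ω) (hN : ∀ i, IsCentral (N i)) :
    BimoduleConnection dA dA Ω where
  nabla := e.nabla dA N
  sigma := e.flip
  sigma_left := e.flip_lact
  sigma_right := e.flip_ract
  right_leibniz ξ a := by
    -- Expanding `ξ` puts the Leibniz term in the form produced by `d(ξ^i a)`. Centrality of `N_i`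
    -- handles the other half, since it turns `(ξ^i a).N_i` into `(ξ^i.N_i).a`.
    have h : ξ ⊠ dA.d a = ∑ i, e.vec i ⊠ (e.coord i ξ ▷ dA.d a) := by
      simp only [← tmul_balanced, e.central _ _]
      rw [← sum_tmul, e.expand]
    simp only [nabla_apply, e.coord_ract, dA.leibniz, tmul_add, mul_lact, ← hN _ a, lact_ract]
    rw [h, sum_ract, ← Finset.sum_add_distrib]
    refine Finset.sum_congr rfl fun i _ => ?_
    rw [add_ract, tmul_ract]
    abel
  left_leibniz a ξ := by
    simp only [nabla_apply, flip_tmul, e.coord_lact, dA.leibniz, tmul_add, mul_lact, lact_sum,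
      lact_add, ← Finset.sum_add_distrib, e.vec_tmul_lact]
    refine Finset.sum_congr rfl fun i _ => ?_
    abel

end CentralFrame
end Frame

/-! ## The central frame of the calculus -/

variable (P) in
/-- the functional `da ↦ (i/ħ) [p_b, a]`, `θ' ↦ 0` -/
def coordY (b : Fin 4) : Form P →ₗ[ℂ] Heis P :=
  functional (innerCompatible_smul (s := I / P.ħ) (innerCompatible_pH b))

variable (P) in
/-- the functional `da ↦ -(i/ħ) [x^b, a]`, `θ' ↦ 0` -/
def coordZ (b : Fin 4) : Form P →ₗ[ℂ] Heis P :=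
  functional (innerCompatible_smul (s := -(I / P.ħ)) (innerCompatible_xH b))

variable (P) in
/-- the functional `da ↦ (i/ħ) [h, a]`, `θ' ↦ 1` -/
def coordT : Form P →ₗ[ℂ] Heis P :=
  functional (innerCompatible_smul (s := I / P.ħ) (innerCompatible_hamiltonian (P := P)))

theorem coordY_d (b : Fin 4) (a : Heis P) :
    coordY P b ((heisCalculus P).d a) = (I / P.ħ) • (pH P b * a - a * pH P b) := by
  rw [coordY, functional_d, smul_mul_assoc, mul_smul_comm, smul_sub]

theorem coordZ_d (b : Fin 4) (a : Heis P) :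
    coordZ P b ((heisCalculus P).d a) = (-(I / P.ħ)) • (xH P b * a - a * xH P b) := by
  rw [coordZ, functional_d, smul_mul_assoc, mul_smul_comm, smul_sub]

theorem coordT_d (a : Heis P) : coordT P ((heisCalculus P).d a)
    = (I / P.ħ) • (hamiltonian P * a - a * hamiltonian P) := by
  rw [coordT, functional_d, smul_mul_assoc, mul_smul_comm, smul_sub]

theorem coordY_theta (b : Fin 4) : coordY P b (θ P) = 0 := by
  rw [coordY, functional_theta, mul_zero, zero_smul]

theorem coordZ_theta (b : Fin 4) : coordZ P b (θ P) = 0 := by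
  rw [coordZ, functional_theta, mul_zero, zero_smul]

theorem coordT_theta : coordT P (θ P) = 1 := by
  rw [coordT, functional_theta, mul_neg, I_div_ħ_mul, neg_neg, one_smul]

theorem coordY_lact (b : Fin 4) (a : Heis P) (ξ : Form P) :
    coordY P b (a ▷ ξ) = a * coordY P b ξ := functional_lact _ a ξ
theorem coordZ_lact (b : Fin 4) (a : Heis P) (ξ : Form P) :
    coordZ P b (a ▷ ξ) = a * coordZ P b ξ := functional_lact _ a ξ
theorem coordT_lact (a : Heis P) (ξ : Form P) :
    coordT P (a ▷ ξ) = a * coordT P ξ := functional_lact _ a ξ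
theorem coordY_ract (b : Fin 4) (a : Heis P) (ξ : Form P) :
    coordY P b (ξ ◁ a) = coordY P b ξ * a := functional_ract _ a ξ
theorem coordZ_ract (b : Fin 4) (a : Heis P) (ξ : Form P) :
    coordZ P b (ξ ◁ a) = coordZ P b ξ * a := functional_ract _ a ξ
theorem coordT_ract (a : Heis P) (ξ : Form P) :
    coordT P (ξ ◁ a) = coordT P ξ * a := functional_ract _ a ξ

theorem coordY_d_fnH (b : Fin 4) (f : P.Fn) :
    coordY P b ((heisCalculus P).d (fnH f)) = fnH (P.pd b f) := by
  rw [coordY_d, pH_comm_fnH, smul_smul, mul_neg, I_div_ħ_mul, neg_neg, one_smul]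

theorem coordY_dx (b a : Fin 4) : coordY P b (dx P a) = if b = a then 1 else 0 := by
  rw [dx, xH, coordY_d_fnH, fnH_pd_coord]

theorem coordY_dp (b c : Fin 4) : coordY P b (dp P c) = (-P.qc) • fnH (P.F b c) := by
  rw [dp, coordY_d, pH_comm_pH, smul_smul, ← mul_assoc, I_div_ħ_mul, neg_one_mul]

theorem coordZ_d_fnH (b : Fin 4) (f : P.Fn) :
    coordZ P b ((heisCalculus P).d (fnH f)) = 0 := by
  rw [coordZ_d, xH, fnH_mul_fnH_sub, smul_zero]

theorem coordZ_dx (b a : Fin 4) : coordZ P b (dx P a) = 0 := coordZ_d_fnH b _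

theorem coordZ_dp (b c : Fin 4) : coordZ P b (dp P c) = if c = b then 1 else 0 := by
  rw [dp, coordZ_d, xH, fnH_comm_pH, fnH_pd_coord, smul_smul, neg_mul, I_div_ħ_mul, neg_neg,
    one_smul]

theorem coordT_d_fnH (f : P.Fn) : coordT P ((heisCalculus P).d (fnH f))
    = ∑ a, eta a a • ((1 / P.mc) • (fnH (P.pd a f) * pH P a)
        - (I * P.ħ / (2 * P.mc)) • fnH (P.pd a (P.pd a f))) := by
  have hħ := StateSpace.ħ_ne (P := P)
  have hm := P.m_ne'
  rw [coordT_d, hamiltonian_comm_fnH]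
  simp only [Finset.smul_sum]
  refine Finset.sum_congr rfl fun a _ => ?_
  match_scalars
  · linear_combination (-(eta a a / P.mc)) * (I_div_ħ_mul (P := P))
  · field_simp

theorem coordT_dx (a : Fin 4) : coordT P (dx P a) = (eta a a / P.mc) • pH P a := by
  rw [dx, coordT_d, hamiltonian_comm_xH]
  match_scalars
  linear_combination (-(eta a a / P.mc)) * (I_div_ħ_mul (P := P))

theorem coordT_dp (c : Fin 4) : coordT P (dp P c)
    = (-(P.qc / (2 * P.mc))) • ∑ a, eta a a •
      ((2 : ℂ) • (fnH (P.F a c) * pH P a) - (I * P.ħ) • fnH (P.F1 a c a)) := by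
  rw [dp, coordT_d, hamiltonian_comm_pH, smul_smul]
  congr 1
  linear_combination (P.qc / (2 * P.mc)) * (I_div_ħ_mul (P := P))

variable (P) in
/-- the central form `dx^a - η^{ab} p_b θ' / m` -/
def yForm (a : Fin 4) : Form P := dx P a - (eta a a / P.mc) • pH P a ▷ θ P

variable (P) in
/-- the central form `dp_c + q F_{ac} dx^a - (iħq/2m) η^{ab} F_{ac,b} θ'` -/
def zForm (c : Fin 4) : Form P := dp P c + P.qc • ∑ a, fnH (P.F a c) ▷ dx P a
  - (I * P.ħ * P.qc / (2 * P.mc)) • ∑ a, eta a a • fnH (P.F1 a c a) ▷ θ P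

/-- Together with the same fact for `z_c`, this is what makes the covariant derivative of the
braiding vanish: `T` sees only the `θ'` component. -/
theorem coordT_yForm (a : Fin 4) : coordT P (yForm P a) = 0 := by
  simp [yForm, coordT_dx, coordT_lact, coordT_theta]

theorem coordT_zForm (c : Fin 4) : coordT P (zForm P c) = 0 := by
  simp only [zForm, map_sub, map_add, map_smul, coordT_lact, coordT_dp, coordT_dx,
    coordT_theta, mul_smul_comm, mul_one, Fin.sum_univ_four]
  module

theorem isCentral_of_generators {ξ : Form P} (hf : ∀ f : P.Fn, ξ ◁ fnH f = fnH f ▷ ξ)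
    (hp : ∀ a, ξ ◁ pH P a = pH P a ▷ ξ) : IsCentral ξ := by
  intro a
  induction a using Heis.induction with
  | h_const c => rw [Algebra.algebraMap_eq_smul_one, ract_smul, ract_one, smul_lact, one_lact]
  | h_fn f => exact hf f
  | h_p a => exact hp a
  | h_add a b ha hb => rw [ract_add, add_lact, ha, hb]
  | h_mul a b ha hb => rw [ract_mul, mul_lact, ha, ← lact_ract, hb]

/-- On both kinds of generators `u` the relations read `[dx^a, u] = (η^{aa}/m) [p_a, u] θ'`, and
subtracting `(η^{aa}/m) p_a θ'` removes exactly this. -/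
theorem isCentral_yForm (a : Fin 4) : IsCentral (yForm P a) := by
  have hθ := isCentral_theta (P := P)
  refine isCentral_of_generators (fun f => ?_) (fun c => ?_)
  · rw [yForm, sub_ract, smul_ract, ← lact_ract, hθ, dx_ract_fnH, ← mul_lact, pH_mul_fnH,
      lact_sub, lact_smul, sub_lact, mul_lact, smul_lact]
    module
  · rw [yForm, sub_ract, smul_ract, ← lact_ract, hθ, dx_ract_pH, ← mul_lact, pH_mul_pH,
      lact_sub, lact_smul, add_lact, mul_lact, smul_lact]
    module

/-- Against `p_d`, the derivative `[q F_{ac}, p_d] dx^a` cancels the `dx` term of `[dp_c, p_d]`, the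
commutator `q F_{ac} [dx^a, p_d]` cancels the quadratic `F F θ'` term, and the commutator of the
last correction cancels the second-derivative term. -/
theorem isCentral_zForm (c : Fin 4) : IsCentral (zForm P c) := by
  have hθ := isCentral_theta (P := P)
  refine isCentral_of_generators (fun f => ?_) (fun d => ?_)
  · simp only [zForm, sub_ract, add_ract, smul_ract, lact_sub, lact_add, lact_smul,
      ← lact_ract, hθ _, dx_ract_fnH, dp_ract_fnH, ← mul_lact, ← fnH_mul,
      mul_comm f, Fin.sum_univ_four]
    module
  · simp only [zForm, sub_ract, add_ract, smul_ract, lact_sub, lact_add, lact_smul,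
      ← lact_ract, hθ _, dx_ract_pH, dp_ract_pH, ← mul_lact, fnH_mul_pH,
      add_lact, smul_lact, Fin.sum_univ_four, F1, F2]
    module

theorem d_algebraMap (c : ℂ) : (heisCalculus P).d (algebraMap ℂ _ c) = 0 := by
  have h := (heisCalculus P).leibniz 1 1
  rw [mul_one, ract_one, one_lact, left_eq_add] at h
  rw [Algebra.algebraMap_eq_smul_one, map_smul, h, smul_zero]

/-- Both sides are additive and compatible with the two actions, because the coordinates are
bimodule maps and the frame is central. The Leibniz rule therefore reduces the claim to `θ'` and to
`d` of functions and of the `p_c`. -/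
theorem expand_form (ξ : Form P) :
    ∑ a, coordY P a ξ ▷ yForm P a + ∑ c, coordZ P c ξ ▷ zForm P c + coordT P ξ ▷ θ P = ξ := by
  have hθ := isCentral_theta (P := P)
  have hl : ∀ (a : Heis P) (ξ : Form P),
      ∑ b, coordY P b (a ▷ ξ) ▷ yForm P b + ∑ c, coordZ P c (a ▷ ξ) ▷ zForm P c
          + coordT P (a ▷ ξ) ▷ θ P
        = a ▷ (∑ b, coordY P b ξ ▷ yForm P b + ∑ c, coordZ P c ξ ▷ zForm P c
          + coordT P ξ ▷ θ P) := by
    intro a ξ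
    simp only [coordY_lact, coordZ_lact, coordT_lact, mul_lact, lact_add, lact_sum]
  have hr : ∀ (a : Heis P) (ξ : Form P),
      ∑ b, coordY P b (ξ ◁ a) ▷ yForm P b + ∑ c, coordZ P c (ξ ◁ a) ▷ zForm P c
          + coordT P (ξ ◁ a) ▷ θ P
        = (∑ b, coordY P b ξ ▷ yForm P b + ∑ c, coordZ P c ξ ▷ zForm P c
          + coordT P ξ ▷ θ P) ◁ a := by
    intro a ξ
    simp only [coordY_ract, coordZ_ract, coordT_ract, mul_lact, add_ract, sum_ract, ← lact_ract,
      hθ _, isCentral_yForm _ _, isCentral_zForm _ _]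
  have ha : ∀ ξ ζ : Form P,
      ∑ b, coordY P b (ξ + ζ) ▷ yForm P b + ∑ c, coordZ P c (ξ + ζ) ▷ zForm P c
          + coordT P (ξ + ζ) ▷ θ P
        = (∑ b, coordY P b ξ ▷ yForm P b + ∑ c, coordZ P c ξ ▷ zForm P c + coordT P ξ ▷ θ P)
          + (∑ b, coordY P b ζ ▷ yForm P b + ∑ c, coordZ P c ζ ▷ zForm P c
            + coordT P ζ ▷ θ P) := by
    intro ξ ζ
    simp only [map_add, add_lact, Finset.sum_add_distrib]
    abel
  induction ξ using Form.induction with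
  | h_zero => simp [zero_lact]
  | h_add ξ ζ h h' => rw [ha, h, h']
  | h_lact a ξ h => rw [hl, h]
  | h_ract a ξ h => rw [hr, h]
  | h_θ => simp [coordY_theta, coordZ_theta, coordT_theta, zero_lact, one_lact]
  | h_d a =>
    induction a using Heis.induction with
    | h_const c => simp [d_algebraMap, zero_lact]
    | h_fn f =>
      conv_rhs => rw [d_fnH]
      simp only [coordY_d_fnH, coordZ_d_fnH, coordT_d_fnH, zero_lact, add_lact, sub_lact,
        smul_lact, yForm, lact_sub, lact_smul, mul_lact, Fin.sum_univ_four]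
      module
    | h_p c =>
      change ∑ b, coordY P b (dp P c) ▷ yForm P b + ∑ b, coordZ P b (dp P c) ▷ zForm P b
        + coordT P (dp P c) ▷ θ P = dp P c
      have h : ∑ b, coordZ P b (dp P c) ▷ zForm P b = zForm P c := by
        rw [Finset.sum_eq_single c (fun b _ h => by rw [coordZ_dp, if_neg h.symm, zero_lact])
          (by simp), coordZ_dp, if_pos rfl, one_lact]
      rw [h]
      simp only [coordY_dp, coordT_dp, yForm, zForm, lact_sub, lact_smul, sub_lact, smul_lact,
        mul_lact, Fin.sum_univ_four, add_lact]
      module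
    | h_add a b h h' => rw [map_add, ha, h, h']
    | h_mul a b h h' => rw [(heisCalculus P).leibniz, ha, hl, hr, h, h']

variable (P) in
/-- the central frame `(y^a, z_c, θ')` -/
def centralFrame : CentralFrame (Fin 4 ⊕ Fin 4 ⊕ Unit) (Heis P) (Form P) where
  vec := Sum.elim (yForm P) (Sum.elim (zForm P) fun _ => θ P)
  coord := Sum.elim (coordY P) (Sum.elim (coordZ P) fun _ => coordT P)
  central := by
    rintro (a | a | _)
    exacts [isCentral_yForm a, isCentral_zForm a, isCentral_theta]
  coord_lact := by
    rintro (a | a | _)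
    exacts [coordY_lact a, coordZ_lact a, coordT_lact]
  coord_ract := by
    rintro (a | a | _)
    exacts [coordY_ract a, coordZ_ract a, coordT_ract]
  expand ξ := by
    simpa [← add_assoc] using expand_form ξ

/-- `dx^a`, `dp_c`, `θ'` form a basis of the left module of one-forms. -/
theorem existsUnique_expansion (ξ : Form P) :
    ∃! c : (Fin 4 → Heis P) × (Fin 4 → Heis P) × Heis P,
      ξ = ∑ a, c.1 a ▷ dx P a + ∑ a, c.2.1 a ▷ dp P a + c.2.2 ▷ θ P := by
  refine existsUnique_of_exists_of_unique ?_ ?_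
  · refine ⟨(fun a => coordY P a ξ + P.qc • ∑ c, coordZ P c ξ * fnH (P.F a c),
      fun c => coordZ P c ξ, coordT P ξ - ∑ a, (eta a a / P.mc) • (coordY P a ξ * pH P a)
        - (I * P.ħ * P.qc / (2 * P.mc)) •
          ∑ c, ∑ a, eta a a • (coordZ P c ξ * fnH (P.F1 a c a))), ?_⟩
    conv_lhs => rw [← expand_form ξ]
    simp only [yForm, zForm, lact_sub, lact_add, lact_smul, lact_sum, add_lact, sub_lact,
      smul_lact, sum_lact, mul_lact, Finset.sum_add_distrib, Finset.sum_sub_distrib]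
    simp only [← Finset.smul_sum]
    rw [Finset.sum_comm (f := fun a c => coordZ P c ξ ▷ fnH (P.F a c) ▷ dx P a)]
    abel
  -- The system is triangular: `Z` reads off the `dp` coefficients, then `Y` determines those of
  -- `dx`, and finally `T` that of `θ'`.
  · intro c c' h h'
    have hZ : ∀ c : (Fin 4 → Heis P) × (Fin 4 → Heis P) × Heis P,
        ξ = ∑ a, c.1 a ▷ dx P a + ∑ a, c.2.1 a ▷ dp P a + c.2.2 ▷ θ P →
        ∀ b, coordZ P b ξ = c.2.1 b := by
      intro c h b
      rw [h]
      simp [coordZ_lact, coordZ_dx, coordZ_dp, coordZ_theta]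
    have hY : ∀ c : (Fin 4 → Heis P) × (Fin 4 → Heis P) × Heis P,
        ξ = ∑ a, c.1 a ▷ dx P a + ∑ a, c.2.1 a ▷ dp P a + c.2.2 ▷ θ P →
        ∀ b, coordY P b ξ = c.1 b + ∑ a, coordZ P a ξ * coordY P b (dp P a) := by
      intro c h b
      simp only [hZ c h]
      conv_lhs => rw [h]
      simp [coordY_lact, coordY_dx, coordY_theta]
    have hT : ∀ c : (Fin 4 → Heis P) × (Fin 4 → Heis P) × Heis P,
        ξ = ∑ a, c.1 a ▷ dx P a + ∑ a, c.2.1 a ▷ dp P a + c.2.2 ▷ θ P →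
        coordT P ξ = ∑ a, c.1 a * coordT P (dx P a) + ∑ a, c.2.1 a * coordT P (dp P a)
          + c.2.2 := by
      intro c h
      conv_lhs => rw [h]
      simp [coordT_lact, coordT_theta]
    have h2 : c.2.1 = c'.2.1 := by
      funext b
      rw [← hZ c h, ← hZ c' h']
    have h1 : c.1 = c'.1 := by
      funext b
      exact add_right_cancel ((hY c h b).symm.trans (hY c' h' b))
    have h3 : c.2.2 = c'.2.2 := by
      have e := (hT c h).symm.trans (hT c' h')
      rw [h1, h2] at e
      exact add_left_cancel e
    exact Prod.ext h1 (Prod.ext h2 h3)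

/-! ## The linear connection on one-forms -/

theorem IsCentral.tmul {A Ω : Type} [Ring A] [Algebra ℂ A] [AddCommGroup Ω] [Module ℂ Ω]
    [Bimodule A A Ω] {ξ ζ : Ω} (hξ : IsCentral ξ) (hζ : IsCentral ζ) : IsCentral (ξ ⊠ ζ) :=
  fun a => by rw [tmul_ract, hζ, ← tmul_balanced, hξ, lact_tmul]

variable (P) in
/-- the covariant derivatives of the frame: `∇ y^d = -(1/m) η^{dc} θ' ⊗ z_c`, `∇ z_c = 0`,
`∇ θ' = 0` -/
def frameNabla : Fin 4 ⊕ Fin 4 ⊕ Unit → BTensor (Form P) (Form P) :=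
  Sum.elim (fun d => (-(eta d d / P.mc)) • (θ P ⊠ zForm P d)) fun _ => 0

theorem isCentral_frameNabla (i : Fin 4 ⊕ Fin 4 ⊕ Unit) : IsCentral (frameNabla P i) := by
  rcases i with d | _
  · intro a
    change ((-(eta d d / P.mc)) • (θ P ⊠ zForm P d)) ◁ a
      = a ▷ ((-(eta d d / P.mc)) • (θ P ⊠ zForm P d))
    rw [smul_ract, lact_smul, isCentral_theta.tmul (isCentral_zForm d)]
  · intro a
    change (0 : BTensor (Form P) (Form P)) ◁ a = a ▷ 0
    rw [zero_ract, lact_zero]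

variable (P) in
/-- the connection with `∇ y^d = -(1/m) η^{dc} θ' ⊗ z_c`, `∇ z_c = 0`, `∇ θ' = 0` whose braiding
flips the central frame -/
def formConnection : BimoduleConnection (heisCalculus P) (heisCalculus P) (Form P) :=
  (centralFrame P).connection (heisCalculus P) (frameNabla P) isCentral_frameNabla

theorem formConnection_nabla (ξ : Form P) : (formConnection P).nabla ξ
    = ∑ a, (yForm P a ⊠ (heisCalculus P).d (coordY P a ξ)
        + coordY P a ξ ▷ ((-(eta a a / P.mc)) • (θ P ⊠ zForm P a)))
      + ∑ c, zForm P c ⊠ (heisCalculus P).d (coordZ P c ξ)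
      + θ P ⊠ (heisCalculus P).d (coordT P ξ) := by
  refine ((centralFrame P).nabla_apply (heisCalculus P) (frameNabla P) ξ).trans ?_
  simp [centralFrame, frameNabla, lact_zero, ← add_assoc]

/-- Frame vectors have constant coordinates, so the differential part of `∇` vanishes on them. -/
theorem d_ite (p : Prop) [Decidable p] : (heisCalculus P).d (if p then 1 else 0) = 0 := by
  split_ifs
  · rw [← map_one (algebraMap ℂ (Heis P)), d_algebraMap]
  · exact map_zero _

theorem nabla_theta : (formConnection P).nabla (θ P) = 0 := by
  have h := d_ite (P := P) True
  rw [if_pos trivial] at h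
  simp [formConnection_nabla, coordY_theta, coordZ_theta, coordT_theta, zero_lact, tmul_zero, h]

theorem nabla_zForm (c : Fin 4) : (formConnection P).nabla (zForm P c) = 0 := by
  have hY : ∀ b, coordY P b (zForm P c) = 0 := by
    intro b
    simp [zForm, coordY_lact, coordY_dp, coordY_dx, coordY_theta]
  have hZ : ∀ b, coordZ P b (zForm P c) = if c = b then 1 else 0 := by
    intro b
    simp [zForm, coordZ_lact, coordZ_dp, coordZ_dx, coordZ_theta]
  simp [formConnection_nabla, hY, hZ, coordT_zForm, zero_lact, tmul_zero, d_ite]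

theorem dx_eq (a : Fin 4) : dx P a = yForm P a + (eta a a / P.mc) • pH P a ▷ θ P := by
  rw [yForm, sub_add_cancel]

theorem dp_eq (c : Fin 4) : dp P c = zForm P c - P.qc • ∑ a, fnH (P.F a c) ▷ dx P a
    + (I * P.ħ * P.qc / (2 * P.mc)) • ∑ a, eta a a • fnH (P.F1 a c a) ▷ θ P := by
  rw [zForm]
  abel

theorem theta_tmul_lact (a : Heis P) (ξ : Form P) : θ P ⊠ (a ▷ ξ) = a ▷ (θ P ⊠ ξ) := by
  rw [← tmul_balanced, isCentral_theta, lact_tmul]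

theorem nabla_dx (d : Fin 4) : (formConnection P).nabla (dx P d)
    = (-(P.qc / P.mc * eta d d)) • ∑ a, fnH (P.F a d) ▷ (θ P ⊠ dx P a)
      + (I * P.ħ * P.qc / (2 * P.mc ^ 2) * eta d d) •
          ∑ a, eta a a • fnH (P.F1 a d a) ▷ (θ P ⊠ θ P) := by
  -- The first term is `θ' ⊗ dT(dx^d)` with `T(dx^d) = (η^{dd}/m) p_d`; the second is the prescribed
  -- `∇y^d`. Their difference involves only `dp_d - z_d`, so no `dp` remains.
  have h : (formConnection P).nabla (dx P d)
      = (eta d d / P.mc) • (θ P ⊠ dp P d) - (eta d d / P.mc) • (θ P ⊠ zForm P d) := by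
    rw [formConnection_nabla, Finset.sum_add_distrib]
    simp only [coordY_dx, coordZ_dx, coordT_dx, d_ite, map_zero, tmul_zero, map_smul, tmul_smul,
      Finset.sum_const_zero, zero_add, add_zero]
    rw [Finset.sum_eq_single d (fun b _ h => by rw [if_neg h, zero_lact]) (by simp), if_pos rfl,
      one_lact, dp]
    module
  rw [h, dp_eq]
  simp only [tmul_add, tmul_sub, tmul_smul, tmul_sum, theta_tmul_lact]
  match_scalars <;> ring

/-! ### The braiding on the coordinate forms -/

theorem sigma_lact (a : Heis P) (ξ ζ : Form P) :
    (formConnection P).sigma ((a ▷ ξ) ⊠ ζ) = a ▷ (formConnection P).sigma (ξ ⊠ ζ) := by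
  rw [← (formConnection P).sigma_left, lact_tmul]

theorem sigma_central_left {ξ : Form P} (h : IsCentral ξ) (ζ : Form P) :
    (formConnection P).sigma (ξ ⊠ ζ) = ζ ⊠ ξ := (centralFrame P).flip_central_left h ζ

theorem sigma_central_right (ξ : Form P) {ζ : Form P} (h : IsCentral ζ) :
    (formConnection P).sigma (ξ ⊠ ζ) = ζ ⊠ ξ := (centralFrame P).flip_central_right ξ h

/-- Only the component `(η^{ee}/m) p_e θ'` of `dx^e` fails to flip freely: its coefficient stays on
the left of `dx^d` under `σ` and stands on the right of it in `dx^d ⊗ dx^e`. The correction is the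
commutator `[dx^d, p_e]`. -/
theorem sigma_dx_dx (e d : Fin 4) : (formConnection P).sigma (dx P e ⊠ dx P d)
    = dx P d ⊠ dx P e
      + (I * P.ħ * P.qc / P.mc ^ 2 * (eta d d * eta e e)) • fnH (P.F e d) ▷ (θ P ⊠ θ P) := by
  rw [dx_eq e]
  simp only [add_tmul, smul_tmul, map_add, map_smul, sigma_lact, tmul_add, tmul_smul,
    sigma_central_left isCentral_theta, sigma_central_left (isCentral_yForm e)]
  rw [← tmul_balanced, dx_ract_pH, F_antisymm d e, fnH_neg, neg_lact]
  simp only [add_tmul, smul_tmul, neg_tmul, smul_neg, ← lact_tmul]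
  module

theorem sigma_dp_dx (e d : Fin 4) : (formConnection P).sigma (dp P e ⊠ dx P d)
    = dx P d ⊠ dp P e
      + (I * P.ħ * P.qc / P.mc * eta d d) •
        (-(∑ a, fnH (P.F1 a e d) ▷ (θ P ⊠ dx P a))
          - (P.qc / P.mc) • ∑ a, eta a a • fnH (P.F a d * P.F a e) ▷ (θ P ⊠ θ P)
          + (I * P.ħ / (2 * P.mc)) • ∑ a, eta a a • fnH (P.F2 a e d a) ▷ (θ P ⊠ θ P)) := by
  rw [dp_eq e]
  simp only [add_tmul, sub_tmul, smul_tmul, sum_tmul, map_add, map_sub, map_sum, map_smul,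
    (formConnection P).sigma_left, tmul_add, tmul_sub, tmul_smul, tmul_sum, sigma_dx_dx,
    ← tmul_balanced,
    sigma_central_left isCentral_theta, sigma_central_left (isCentral_zForm e), dx_ract_fnH,
    ← lact_tmul, lact_add, lact_smul, ← mul_lact, ← fnH_mul, mul_comm (P.F _ d)]
  -- Commuting `dx^d` past `F_{ae,a}` produces the derivatives in the opposite order to the
  -- statement.
  simp only [P.F2_comm _ e d _]
  simp only [F1, F2, Fin.sum_univ_four]
  module

/-- Here the second factor is expanded: `z_c` and `θ'` are central and flip, and the rest is the
braiding of `dx` with `dx`. The corrections arise from moving the coefficients `F_{dc}` and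
`F_{bc,b}` across `dx^a`. -/
theorem sigma_dx_dp (a c : Fin 4) : (formConnection P).sigma (dx P a ⊠ dp P c)
    = dp P c ⊠ dx P a
      + (I * P.ħ * P.qc / P.mc * eta a a) • (∑ d, fnH (P.F1 d c a) ▷ (dx P d ⊠ θ P))
      - (I * P.ħ * P.qc ^ 2 / P.mc ^ 2 * eta a a) •
          (∑ b, eta b b • fnH (P.F b c * P.F a b) ▷ (θ P ⊠ θ P))
      - (I * P.ħ * (I * P.ħ) * P.qc / (2 * P.mc ^ 2) * eta a a) •
          ∑ b, eta b b • fnH (P.F2 b c b a) ▷ (θ P ⊠ θ P) := by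
  rw [dp_eq c]
  simp only [add_tmul, sub_tmul, smul_tmul, sum_tmul, map_add, map_sub, map_sum, map_smul,
    (formConnection P).sigma_left, tmul_add, tmul_sub, tmul_smul, tmul_sum, sigma_dx_dx,
    ← tmul_balanced,
    sigma_central_left isCentral_theta, sigma_central_right _ isCentral_theta,
    sigma_central_right _ (isCentral_zForm c), dx_ract_fnH,
    ← lact_tmul, lact_add, lact_smul, ← mul_lact, ← fnH_mul]
  simp only [F1, F2, Fin.sum_univ_four]
  module

/-- Expanding the first `dp_e` leaves the flip of `z_e`, the braidings of `dx` with `dp_d`, and the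
commutators of `dp_d` with the coefficients of `dp_e`. -/
theorem sigma_dp_dp (e d : Fin 4) : (formConnection P).sigma (dp P e ⊠ dp P d)
    = dp P d ⊠ dp P e
      + (I * P.ħ * P.qc ^ 2 / P.mc) • (∑ r, eta r r •
          ∑ a, (fnH (P.F r d * P.F1 a e r) ▷ (θ P ⊠ dx P a)
            - fnH (P.F r e * P.F1 a d r) ▷ (dx P a ⊠ θ P)))
      + (I * P.ħ * P.qc ^ 3 / P.mc ^ 2) • (∑ r, eta r r • ∑ a, eta a a •
          (fnH (P.F r e * P.F a d * P.F r a) ▷ (θ P ⊠ θ P)))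
      - (I * P.ħ * (I * P.ħ) * P.qc ^ 2 / (2 * P.mc ^ 2)) • (∑ r, eta r r • ∑ a, eta a a •
          (fnH (P.F r d * P.F2 a e a r) ▷ (θ P ⊠ θ P)
            - fnH (P.F a e * P.F2 r d r a) ▷ (θ P ⊠ θ P))) := by
  rw [dp_eq e]
  simp only [add_tmul, sub_tmul, smul_tmul, sum_tmul, map_add, map_sub, map_sum, map_smul,
    (formConnection P).sigma_left, tmul_add, tmul_sub, tmul_smul, tmul_sum, sigma_dx_dp,
    ← tmul_balanced,
    sigma_central_left isCentral_theta, sigma_central_left (isCentral_zForm e), dp_ract_fnH,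
    ← lact_tmul, lact_add, lact_sub, lact_smul, lact_sum, ← mul_lact, ← fnH_mul]
  simp only [← mul_assoc, F1, F2, Fin.sum_univ_four]
  module

/-! ### The covariant derivative of `dp` -/

theorem nabla_fnH_lact (f : P.Fn) (ξ : Form P) : (formConnection P).nabla (fnH f ▷ ξ)
    = fnH f ▷ (formConnection P).nabla ξ
      + (∑ a, fnH (P.pd a f) ▷ (formConnection P).sigma (dx P a ⊠ ξ)
        - (I * P.ħ / (2 * P.mc)) • ∑ a, eta a a • fnH (P.pd a (P.pd a f)) ▷ (ξ ⊠ θ P)) := by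
  rw [(formConnection P).left_leibniz, d_fnH]
  simp only [sub_tmul, sum_tmul, smul_tmul, map_sub, map_sum, map_smul, sigma_lact,
    sigma_central_left isCentral_theta]

theorem xiForm_eq (c : Fin 4) : xiForm P c
    = (-(I * P.ħ * P.qc / (2 * P.mc))) • ∑ n, eta n n • ∑ a, fnH (P.F2 a c n n) ▷ dx P a := by
  simp only [xiForm, ← Finset.smul_sum, sum_eta_smul]

theorem etaForm_eq (c : Fin 4) : etaForm P c
    = (-(I * P.ħ * P.qc / (2 * P.mc))) • (∑ n, eta n n • ∑ a, fnH (P.F2 n c n a) ▷ dx P a)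
      - (P.qc ^ 2 / P.mc) • ∑ e, eta e e • ∑ a, fnH (P.F e c * P.F a e) ▷ dx P a := by
  simp only [etaForm, ← Finset.smul_sum, sum_eta_smul]

theorem Ncoef_eq (c : Fin 4) : Ncoef P c
    = (-(I * P.ħ * P.qc ^ 2 / (2 * P.mc ^ 2))) • (∑ n, eta n n • ∑ a, eta a a •
        ((2 : ℂ) • (P.F a n * P.F1 n c a) + P.F1 a n a * P.F n c))
      + (P.ħ ^ 2 * P.qc / (4 * P.mc ^ 2)) • ∑ n, eta n n • ∑ a, eta a a • P.F3 a c a n n := by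
  simp only [Ncoef, mul_smul, ← Finset.smul_sum, sum_eta_smul]

/-- Since `z_c` is parallel, `∇(dp_c)` comes entirely from the `dx` and `θ'` components of `dp_c`,
through the left Leibniz rule and the known `∇(dx^a)` and braiding. -/
theorem nabla_dp (c : Fin 4) : (formConnection P).nabla (dp P c)
    = -(P.qc • ∑ d, ∑ e, fnH (P.F1 d c e) ▷ (dx P d ⊠ dx P e))
      - xiForm P c ⊠ θ P - θ P ⊠ etaForm P c + fnH (Ncoef P c) ▷ (θ P ⊠ θ P) := by
  -- The real coefficient is put into the `(iħ)(iħ)` convention in which the rest of the computation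
  -- is carried out.
  have hI : P.ħ ^ 2 * P.qc / (4 * P.mc ^ 2)
      = -(I * P.ħ * P.qc / (2 * P.mc) * (I * P.ħ / (2 * P.mc))) := by
    linear_combination (P.ħ ^ 2 * P.qc / (4 * P.mc ^ 2)) * Complex.I_sq
  rw [xiForm_eq, etaForm_eq, Ncoef_eq, hI, dp_eq]
  simp only [map_add, map_sub, map_smul, map_sum, nabla_zForm, nabla_fnH_lact, nabla_dx,
    nabla_theta, sigma_dx_dx, sigma_central_right _ isCentral_theta, lact_zero,
    tmul_sub, smul_tmul, sum_tmul, tmul_smul, tmul_sum, theta_tmul_lact, ← lact_tmul,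
    lact_add, lact_smul, lact_sum, ← mul_lact, ← fnH_mul, fnH_add, fnH_smul, fnH_sum,
    add_lact, smul_lact, sum_lact, smul_add, mul_comm (P.pd _ (P.F _ c)), mul_comm (P.F _ c)]
  simp only [F1, F2, F3, Fin.sum_univ_four]
  module

/-! ## The Klein–Gordon connection -/

namespace StateSpace

variable (E : StateSpace P)

theorem rep_fnH (f : P.Fn) : E.rep (fnH f) = E.mulFn f := by
  rw [fnH, rep_mk, FreeAlgebra.lift_ι_apply, Sum.elim_inl]

theorem rep_pH (a : Fin 4) : E.rep (pH P a) = (-(I * P.ħ)) • E.D a := by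
  rw [pH, rep_mk, FreeAlgebra.lift_ι_apply, Sum.elim_inr]

theorem dds_mulFn (f : P.Fn) : E.dds * E.mulFn f = E.mulFn f * E.dds := by
  ext φ z
  have h : HasFDerivAt (fun z : ℝ × Spacetime => f.1 z.2)
      ((fderiv ℝ f.1 z.2).comp (ContinuousLinearMap.snd ℝ ℝ Spacetime)) z :=
    (differentiable_fn f z.2).hasFDerivAt.comp z hasFDerivAt_snd
  change timeD (fun z => f.1 z.2 * φ.1 z) z = f.1 z.2 * timeD φ.1 z
  have h' : fderiv ℝ (fun z : ℝ × Spacetime => f.1 z.2 * φ.1 z) z = _ :=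
    (h.mul (E.diff φ z).hasFDerivAt).fderiv
  simp only [timeD, h', add_apply, smul_apply, smul_eq_mul, ContinuousLinearMap.comp_apply,
    ContinuousLinearMap.coe_snd', map_zero]
  ring

theorem dds_mulLine (b : Line) :
    E.dds * E.mulLine b = E.mulLine b * E.dds + E.mulLine (Line.deriv b) := by
  ext φ z
  have hb : Differentiable ℝ b.1 := by
    have h : ContDiff ℝ ∞ b.1 := b.2
    exact h.differentiable (by simp)
  have h : HasFDerivAt (fun z : ℝ × Spacetime => b.1 z.1)
      ((fderiv ℝ b.1 z.1).comp (ContinuousLinearMap.fst ℝ ℝ Spacetime)) z :=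
    (hb z.1).hasFDerivAt.comp z hasFDerivAt_fst
  change timeD (fun z => b.1 z.1 * φ.1 z) z
    = b.1 z.1 * timeD φ.1 z + _root_.deriv b.1 z.1 * φ.1 z
  have h' : fderiv ℝ (fun z : ℝ × Spacetime => b.1 z.1 * φ.1 z) z = _ :=
    (h.mul (E.diff φ z).hasFDerivAt).fderiv
  simp only [timeD, h', add_apply, smul_apply, smul_eq_mul, ContinuousLinearMap.comp_apply,
    ContinuousLinearMap.coe_fst', fderiv_apply_one_eq_deriv]
  ring

/-- The potential does not depend on `s`, and the mixed second derivatives of `φ` agree. -/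
theorem dds_D (a : Fin 4) : E.dds * E.D a = E.D a * E.dds := by
  ext φ z
  have hφ := E.smooth φ.1 φ.2
  have hA : Differentiable ℝ (fun y => (P.pot a y : ℂ)) :=
    (Complex.ofRealCLM.contDiff.comp (P.pot_smooth a)).differentiable (by simp)
  have hd : Differentiable ℝ (fderiv ℝ φ.1) :=
    (hφ.fderiv_right (m := ∞) (by simp)).differentiable (by simp)
  have h2 : ∀ v w : ℝ × Spacetime, fderiv ℝ (fun y => fderiv ℝ φ.1 y v) z w
      = fderiv ℝ (fderiv ℝ φ.1) z w v := by
    intro v w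
    rw [fderiv_clm_apply (hd z) (differentiableAt_const v)]
    simp
  have hsym : ∀ v w : ℝ × Spacetime, fderiv ℝ (fderiv ℝ φ.1) z w v
      = fderiv ℝ (fderiv ℝ φ.1) z v w := fun v w =>
    (hφ.contDiffAt.isSymmSndFDerivAt (by
      rw [minSmoothness_of_isRCLikeNormedField]; exact ENat.LEInfty.out)) w v
  have hd1 : DifferentiableAt ℝ (fun y => fderiv ℝ φ.1 y (0, Pi.single a 1)) z :=
    (hd z).clm_apply (differentiableAt_const _)
  have h : HasFDerivAt (fun z : ℝ × Spacetime => (P.pot a z.2 : ℂ))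
      ((fderiv ℝ (fun y => (P.pot a y : ℂ)) z.2).comp (ContinuousLinearMap.snd ℝ ℝ Spacetime)) z :=
    (hA z.2).hasFDerivAt.comp z hasFDerivAt_snd
  have h3 := h.mul (E.diff φ z).hasFDerivAt
  have he : covD P a φ.1 = fun y => fderiv ℝ φ.1 y (0, Pi.single a 1)
      - (I * (P.qc / P.ħ)) * ((fun z : ℝ × Spacetime => (P.pot a z.2 : ℂ)) * φ.1) y := by
    funext y
    simp only [covD, Pi.mul_apply]
    ring
  change timeD (covD P a φ.1) z = covD P a (fun y => fderiv ℝ φ.1 y (1, 0)) z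
  rw [timeD, he, fderiv_fun_sub hd1 (h3.differentiableAt.const_mul _),
    fderiv_const_mul h3.differentiableAt, h3.fderiv]
  simp only [covD, sub_apply, add_apply, smul_apply, smul_eq_mul, h2,
    ContinuousLinearMap.comp_apply, ContinuousLinearMap.coe_snd', map_zero]
  rw [hsym]
  ring

theorem dds_rep (a : Heis P) : E.dds * E.rep a = E.rep a * E.dds := by
  induction a using Heis.induction with
  | h_const c => rw [AlgHom.commutes]; exact (Algebra.commutes _ _).symm
  | h_fn f => rw [rep_fnH, dds_mulFn]
  | h_p a => rw [rep_pH, mul_smul_comm, dds_D, smul_mul_assoc]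
  | h_add a b ha hb => rw [map_add, mul_add, add_mul, ha, hb]
  | h_mul a b ha hb => rw [map_mul, ← mul_assoc, ha, mul_assoc, hb, mul_assoc]

/-- Substituting `p_a = -iħ D_a`, the second-order part of the operator is the Schrödinger
representation of `(i/ħ) h`. This ties `∇_E` to the coordinate `T`. -/
theorem kleinGordon_eq : E.kleinGordon = E.dds + E.rep ((I / P.ħ) • hamiltonian P) := by
  have hħ := ħ_ne (P := P)
  have hm := P.m_ne'
  refine LinearMap.ext fun φ => ?_
  simp only [kleinGordon, hamiltonian, map_smul, map_sum, map_mul, rep_pH, LinearMap.sub_apply,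
    LinearMap.add_apply, LinearMap.smul_apply, LinearMap.sum_apply, Module.End.mul_apply,
    sum_eta_smul]
  simp only [Finset.smul_sum, smul_smul, sub_eq_add_neg, ← Finset.sum_neg_distrib, ← neg_smul]
  congr 1
  refine Finset.sum_congr rfl fun a _ => ?_
  congr 1
  field_simp
  linear_combination (-eta a a) * Complex.I_sq

/-- `∂_s` commutes with the represented algebra, so the commutator with the operator is `(i/ħ)[h, a]
= T(da)`. This is the left Leibniz rule of `∇_E`. -/
theorem kleinGordon_lact (a : Heis P) (φ : E.space) : E.kleinGordon (a ▷ φ)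
    = a ▷ E.kleinGordon φ + coordT P ((heisCalculus P).d a) ▷ φ := by
  have h : E.kleinGordon * E.rep a
      = E.rep a * E.kleinGordon + E.rep (coordT P ((heisCalculus P).d a)) := by
    rw [kleinGordon_eq, coordT_d, add_mul, mul_add, dds_rep, ← map_mul, ← map_mul, add_assoc,
      ← map_add]
    congr 2
    rw [smul_mul_assoc, mul_smul_comm, smul_sub]
    abel
  exact LinearMap.congr_fun h φ

theorem kleinGordon_ract (φ : E.space) (b : Line) : E.kleinGordon (φ ◁ b)
    = E.kleinGordon φ ◁ b + φ ◁ Line.deriv b := by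
  have h : E.kleinGordon * E.mulLine b
      = E.mulLine b * E.kleinGordon + E.mulLine (Line.deriv b) := by
    rw [kleinGordon_eq, add_mul, mul_add, dds_mulLine, rep_mulLine]
    abel
  exact LinearMap.congr_fun h φ

theorem nablaE_apply (φ : E.space) : E.nablaE φ = E.kleinGordon φ ⊠ ds := rfl

theorem ds_ract (b : Line) : ds ◁ b = b ▷ ds := rfl

theorem lact_ds (b : Line) : b ▷ ds = toForm b := by rw [ds, lact_toForm, mul_one]

/-- `ξ ⊗ φ ↦ X(ξ) φ ⊗ ds` -/
def braiding : BTensor (Form P) E.space →ₗ[ℂ] BTensor E.space LineForm :=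
  BTensor.lift
    (LinearMap.mk₂ ℂ (fun ξ φ => (coordT P ξ ▷ φ) ⊠ ds)
      (fun ξ ξ' φ => by rw [map_add, add_lact, add_tmul])
      (fun c ξ φ => by rw [map_smul, smul_lact, smul_tmul])
      (fun ξ φ φ' => by rw [lact_add, add_tmul])
      (fun c ξ φ => by rw [lact_smul, smul_tmul]))
    (fun ξ a φ => by simp only [LinearMap.mk₂_apply, coordT_ract, mul_lact])

theorem braiding_tmul (ξ : Form P) (φ : E.space) :
    E.braiding (ξ ⊠ φ) = (coordT P ξ ▷ φ) ⊠ ds := BTensor.lift_tmul _ _ _ _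

/-- the bimodule connection `∇_E φ = (∂_s φ - (iħ/2m) η^{ab} D_a D_b φ) ⊗ ds` -/
def connection : BimoduleConnection (heisCalculus P) lineCalculus E.space where
  nabla := E.nablaE
  sigma := E.braiding
  sigma_left a z := by
    have : E.braiding.comp (Bimodule.left (B := Line) a)
        = (Bimodule.left (B := Line) a).comp E.braiding := by
      refine BTensor.hom_ext fun ξ φ => ?_
      change E.braiding (a ▷ (ξ ⊠ φ)) = a ▷ E.braiding (ξ ⊠ φ)
      rw [lact_tmul, braiding_tmul, braiding_tmul, coordT_lact, mul_lact, lact_tmul]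
    exact LinearMap.congr_fun this z
  sigma_right z b := by
    have : E.braiding.comp (Bimodule.right (A := Heis P) (op b))
        = (Bimodule.right (A := Heis P) (op b)).comp E.braiding := by
      refine BTensor.hom_ext fun ξ φ => ?_
      change E.braiding ((ξ ⊠ φ) ◁ b) = E.braiding (ξ ⊠ φ) ◁ b
      rw [tmul_ract, braiding_tmul, braiding_tmul, lact_ract, tmul_ract, ds_ract, tmul_balanced]
    exact LinearMap.congr_fun this z
  right_leibniz φ b := by
    change E.nablaE (φ ◁ b) = E.nablaE φ ◁ b + φ ⊠ toForm (Line.deriv b)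
    rw [nablaE_apply, nablaE_apply, kleinGordon_ract, add_tmul, tmul_balanced, tmul_balanced,
      tmul_ract, ds_ract, lact_ds (Line.deriv b)]
  left_leibniz a φ := by
    rw [nablaE_apply, nablaE_apply, kleinGordon_lact, add_tmul, lact_tmul, braiding_tmul]

theorem connection_sigma_tmul (ξ : Form P) (φ : E.space) :
    E.connection.sigma (ξ ⊠ φ) = (coordT P ξ ▷ φ) ⊠ ds := E.braiding_tmul ξ φ

theorem connection_nabla (φ : E.space) : E.connection.nabla φ = E.kleinGordon φ ⊠ ds := rfl

theorem mapLeft_tmul {A B C D M M' N : Type} [Ring A] [Algebra ℂ A] [Ring B] [Algebra ℂ B]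
    [Ring C] [Algebra ℂ C] [Ring D] [Algebra ℂ D]
    [AddCommGroup M] [Module ℂ M] [AddCommGroup M'] [Module ℂ M'] [AddCommGroup N] [Module ℂ N]
    [Bimodule A B M] [Bimodule D B M'] [Bimodule B C N] (f : M →ₗ[ℂ] M')
    (hf : ∀ (m : M) (b : B), f (m ◁ b) = f m ◁ b) (m : M) (n : N) :
    BTensor.mapLeft f hf (m ⊠ n) = f m ⊠ n := BTensor.lift_tmul _ _ _ _

/-- `(σ_E ⊗ id)(id ⊗ σ_E)` evaluated on `ξ ⊗ ζ ⊗ φ` is `X(ξ) X(ζ) φ ⊗ ds ⊗ ds`. -/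
theorem mapLeft_idSigma (ξ ζ : Form P) (φ : E.space) :
    BTensor.mapLeft E.connection.sigma E.connection.sigma_right
        (idSigma (Form P) E.connection φ (ξ ⊠ ζ))
      = (((coordT P ξ * coordT P ζ) ▷ φ) ⊠ ds) ⊠ ds := by
  rw [idSigma_tmul, connection_sigma_tmul, BTensor.reassoc_tmul, mapLeft_tmul,
    connection_sigma_tmul, mul_lact]

theorem mapLeft_idSigma_lact (a : Heis P) (ξ ζ : Form P) (φ : E.space) :
    BTensor.mapLeft E.connection.sigma E.connection.sigma_right
        (idSigma (Form P) E.connection φ (a ▷ (ξ ⊠ ζ)))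
      = (((a * coordT P ξ * coordT P ζ) ▷ φ) ⊠ ds) ⊠ ds := by
  rw [lact_tmul, mapLeft_idSigma, coordT_lact]

/-- Only three contributions occur: `K T(ξ) φ` from differentiating the braided element, and `T(ξ) K
φ` and `(T·T)(∇ξ) φ` from braiding the differentiated one. In the last, the terms of `∇ξ` containing
some `y^a` or `z_c` vanish, including the prescribed `θ' ⊗ z_a`, which leaves `T(dT(ξ))`. -/
theorem doubleNabla_eq_zero :
    doubleNabla (formConnection P) lineConnection E.connection = 0 := by
  refine BTensor.hom_ext fun ξ φ => ?_
  have hds : lineConnection.nabla ds = 0 := by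
    change toForm (Line.deriv 1) ⊠ ds = 0
    have : Line.deriv 1 = 0 := by
      ext s
      exact deriv_const s (1 : ℂ)
    rw [this, map_zero, zero_tmul]
  rw [doubleNabla, LinearMap.sub_apply, LinearMap.comp_apply, LinearMap.comp_apply,
    connection_sigma_tmul, tensorNabla_tmul, tensorNabla_tmul, hds, tmul_zero, map_zero, add_zero,
    connection_nabla, connection_nabla, kleinGordon_lact, map_add, BTensor.reassoc_tmul,
    mapLeft_tmul, connection_sigma_tmul, formConnection_nabla, idSigma_tmul]
  -- The braiding on the line is the identity, so the first term is already a tensor with `ds ⊗ ds`.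
  change BTensor.reassoc _ _ _ (_ ⊠ (ds ⊠ ds)) - _ = 0
  simp only [BTensor.reassoc_tmul, map_add, map_sum, lact_smul, map_smul, mapLeft_idSigma,
    mapLeft_idSigma_lact, coordT_yForm, coordT_zForm, coordT_theta, zero_mul, mul_zero, one_mul,
    zero_lact, zero_tmul, smul_zero, add_zero, Finset.sum_const_zero, zero_add, add_tmul]
  abel

end StateSpace

end QGeo

end

/-! ### Comparison with the index formulas of the theorem -/

open QGeo
open Complex (I)
theorem theorem5p2 (P : Background) :
    (∀ ξ : Form P, ∃! c : (Fin 4 → Heis P) × (Fin 4 → Heis P) × Heis P,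
      ξ = ∑ a, c.1 a ▷ dx P a + ∑ a, c.2.1 a ▷ dp P a + c.2.2 ▷ θ P) ∧
    ∃ cA : BimoduleConnection (heisCalculus P) (heisCalculus P) (Form P),
      cA.nabla (θ P) = 0 ∧
      (∀ d, cA.nabla (dx P d) =
        -((P.qc / P.mc) • ∑ a, ∑ c, eta c d • (fnH (P.F a c) ▷ (θ P ⊠ dx P a)))
          + θ P ⊠ ((I * P.ħ * P.qc / (2 * P.mc ^ 2)) •
              ∑ a, ∑ b, ∑ c, (eta a b * eta c d) • (fnH (P.F1 b c a) ▷ θ P))) ∧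
      (∀ c, cA.nabla (dp P c) =
        -(P.qc • ∑ d, ∑ e, fnH (P.F1 d c e) ▷ (dx P d ⊠ dx P e))
          - xiForm P c ⊠ θ P - θ P ⊠ etaForm P c + fnH (Ncoef P c) ▷ (θ P ⊠ θ P)) ∧
      (∀ ξ, cA.sigma (θ P ⊠ ξ) = ξ ⊠ θ P) ∧
      (∀ ξ, cA.sigma (ξ ⊠ θ P) = θ P ⊠ ξ) ∧
      (∀ e d, cA.sigma (dx P e ⊠ dx P d) = dx P d ⊠ dx P e
        + (I * P.ħ * P.qc / P.mc ^ 2) •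
            ∑ a, ∑ c, (eta c d * eta a e) • (fnH (P.F a c) ▷ (θ P ⊠ θ P))) ∧
      (∀ e d, cA.sigma (dp P e ⊠ dx P d) = dx P d ⊠ dp P e
        + (I * P.ħ * P.qc / P.mc) • ∑ c, eta d c • (θ P ⊠
            (-(∑ a, fnH (P.F1 a e c) ▷ dx P a)
              - (P.qc / P.mc) • (∑ a, ∑ b, eta a b • (fnH (P.F a c * P.F b e) ▷ θ P))
              + (I * P.ħ / (2 * P.mc)) • ∑ a, ∑ b, eta a b • (fnH (P.F2 a e c b) ▷ θ P)))) ∧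
      (∀ a c, cA.sigma (dx P a ⊠ dp P c) = dp P c ⊠ dx P a
        + (I * P.ħ * P.qc / P.mc) •
            (∑ d, ∑ e, eta e a • (fnH (P.F1 d c e) ▷ (dx P d ⊠ θ P)))
        - ((I * P.ħ * P.qc ^ 2 / P.mc ^ 2) •
              (∑ b, ∑ n, ∑ r, (eta b n * eta r a) • (fnH (P.F n c * P.F r b) ▷ (θ P ⊠ θ P)))
            - (P.ħ ^ 2 * P.qc / (2 * P.mc ^ 2)) •
              ∑ b, ∑ n, ∑ r, (eta a r * eta n b) • (fnH (P.F2 b c n r) ▷ (θ P ⊠ θ P)))) ∧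
      (∀ e d, cA.sigma (dp P e ⊠ dp P d) = dp P d ⊠ dp P e
        + (I * P.ħ * P.qc ^ 2 / P.mc) • (∑ r, ∑ p, ∑ a, eta r p •
            (fnH (P.F r d * P.F1 a e p) ▷ (θ P ⊠ dx P a)
              - fnH (P.F r e * P.F1 a d p) ▷ (dx P a ⊠ θ P)))
        + (I * P.ħ * P.qc ^ 3 / P.mc ^ 2) • (∑ r, ∑ p, ∑ a, ∑ b, (eta r p * eta b a) •
            (fnH (P.F p e * P.F a d * P.F r b) ▷ (θ P ⊠ θ P)))
        + (P.ħ ^ 2 * P.qc ^ 2 / (2 * P.mc ^ 2)) • (∑ r, ∑ p, ∑ a, ∑ b, (eta r p * eta a b) •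
            (fnH (P.F p d * P.F2 b e a r - P.F2 p d a r * P.F b e) ▷ (θ P ⊠ θ P)))) ∧
      ∀ E : StateSpace P, ∃ cE : BimoduleConnection (heisCalculus P) lineCalculus E.space,
        cE.nabla = E.nablaE ∧
        (∀ φ, cE.sigma (θ P ⊠ φ) = φ ⊠ ds) ∧
        (∀ a φ, cE.sigma (dx P a ⊠ φ) =
          (-(I * P.ħ / P.mc) • ∑ b, eta a b • E.D b φ) ⊠ ds) ∧
        (∀ c φ, cE.sigma (dp P c ⊠ φ) = (Xdp P c ▷ φ) ⊠ ds) ∧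
        doubleNabla cA lineConnection cE = 0 := by

  refine ⟨existsUnique_expansion, formConnection P, nabla_theta, fun d => ?_, nabla_dp,
    sigma_central_left isCentral_theta, fun ξ => sigma_central_right ξ isCentral_theta,
    fun e d => ?_, fun e d => ?_, fun a c => ?_, fun e d => ?_, fun E =>
    ⟨E.connection, rfl, fun φ => ?_, fun a φ => ?_, fun c φ => ?_, E.doubleNabla_eq_zero⟩⟩
  · rw [nabla_dx]
    simp only [mul_smul, ← Finset.smul_sum, sum_eta_smul, sum_eta_smul', tmul_smul, tmul_sum,
      theta_tmul_lact]
    simp only [Fin.sum_univ_four]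
    module
  · rw [sigma_dx_dx]
    simp only [mul_smul, ← Finset.smul_sum, sum_eta_smul']
  · rw [sigma_dp_dx]
    simp only [mul_smul, sum_eta_smul, tmul_add, tmul_sub,
      tmul_neg, tmul_smul, tmul_sum, theta_tmul_lact]
  · rw [sigma_dx_dp]
    have hI : P.ħ ^ 2 * P.qc / (2 * P.mc ^ 2) = -(I * P.ħ * (I * P.ħ) * P.qc / (2 * P.mc ^ 2)) := by
      linear_combination (P.ħ ^ 2 * P.qc / (2 * P.mc ^ 2)) * Complex.I_sq
    rw [hI]
    simp only [mul_smul, ← Finset.smul_sum, sum_eta_smul, sum_eta_smul']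
    simp only [Fin.sum_univ_four]
    module
  · rw [sigma_dp_dp]
    have hI : P.ħ ^ 2 * P.qc ^ 2 / (2 * P.mc ^ 2)
        = -(I * P.ħ * (I * P.ħ) * P.qc ^ 2 / (2 * P.mc ^ 2)) := by
      linear_combination (P.ħ ^ 2 * P.qc ^ 2 / (2 * P.mc ^ 2)) * Complex.I_sq
    -- Exchanging the mixed partials and the commuting functions brings the last product to the
    -- order used in `sigma_dp_dp`.
    have hF : ∀ r a, P.F2 r d a r * P.F a e = P.F a e * P.F2 r d r a := fun r a => by
      rw [P.F2_comm, mul_comm]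
    rw [hI]
    simp only [mul_smul, ← Finset.smul_sum, sum_eta_smul, sum_eta_smul', hF, fnH_sub, sub_lact]
    module
  · rw [E.connection_sigma_tmul, coordT_theta, one_lact]
  · rw [E.connection_sigma_tmul, coordT_dx, sum_eta_smul, smul_lact]
    change ((eta a a / P.mc) • E.rep (pH P a) φ) ⊠ ds = _
    rw [E.rep_pH, LinearMap.smul_apply, smul_smul, smul_smul]
    congr 2
    ring
  · rw [E.connection_sigma_tmul, coordT_dp]
    congr 2
    simp only [Xdp, sum_eta_smul]
    -- `T(dp_c)` is expressed through `F_{ac}` with an overall minus sign; antisymmetry absorbs it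
    -- into the `F_{ca}` of `Xdp`.
    simp only [P.F_antisymm c, P.F1_antisymm c, fnH_neg, neg_mul,
      Fin.sum_univ_four]
    module
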